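/- **Setting.** For a complete locally compact metric space $(X,d)$ let $\varphi_{y,z}(x)=d(x,y)-d(x,z)$, and let $\mathcal G(X,d)$ be the norm-closed subalgebra of $C_b(X)$ generated by the constants, the functions vanishing at infinity and all $\varphi_{y,z}$. The *metric compactification* $\overline X_d$ is the maximal ideal space of the commutative C*-algebra $\mathcal G(X,d)$; $X$ maps to it by evaluation, and $\partial_d X=\overline X_d\setminus X$ is the *metric boundary*. Let $T\subseteq[0,\infty)$ be unbounded with $0\in T$. A map $\gamma:T\to X$ is a *geodesic ray* if $d(\gamma(s),\gamma(t))=|s-t|$ for all $s,t\in T$, and an *almost-geodesic ray* if for every $\varepsilon>0$ there is an integer $N$ with $|d(\gamma(t),\gamma(s))+d(\gamma(s),\gamma(0))-t|<\varepsilon$ for all $t\ge s\ge N$ in $T$. A *Busemann point* is a point of $\partial_d X$ which is the limit of an almost-geodesic ray. In a connected graph with its path metric, the *perimeter* of a triple of vertices is the sum of the three distances. Two paths ending at the same vertex *share a tail* if they have a common terminal segment with at least one edge. A triple of distinct vertices is *rigid* if for each of its vertices $x$, with $y,z$ the other two, no minimal paths $[x,y]$ and $[x,z]$ share a vertex other than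 $x$. Let us say that a pair of vertices $u,v$ and a sequence of vertices $(c_j)$ *give non-Busemann points* if for $j\ge1$ no minimal paths $[u,c_j]$, $[v,c_j]$ share a tail, the perimeter of $\{u,v,c_j\}$ tends to infinity, and the set of accumulation points of $(c_j)$ in the metric compactification is non-empty and consists of points of the metric boundary that are not Busemann points. **Example (discrete Heisenberg group).** Let $H$ be the group of matrices $[m,n,k]=\begin{pmatrix}1&m&n\\0&1&k\\0&0&1\end{pmatrix}$ with $m,n,k\in\mathbb Z$, and let $a=[1,0,0]$, $b=[0,0,1]$. Then $S=\{a,b,a^{-1},b^{-1}\}$ generates $H$. Give $H$ the path metric of its Cayley graph with respect to $S$ (edges join $g$ and $gs$, $s\in S$), and let $e$ be the identity. 1. Let $x=aba^{-1}b$ and $c_j=b^{j-1}ab$. For $j\ge1$ the word $b^{j-1}ab$ labels the unique minimal path from $e$ to $c_j$. For $j\ge2$ the word $b^{j-2}a$ labels the unique minimal path from $x$ to $c_j$, and $\{e,x,c_j\}$ has perimeter $4+2j$. The pair $e,x$ and the sequence $(c_j)$ give non-Busemann points. 2. The pair $e,\ a^{-1}bab$ with the sequence $b^{j+1}a^{-1}b$,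 and the pair $e,\ x$ with the sequence $b^{j+1}a^{-1}$, also give non-Busemann points, and in both cases no accumulation point of the sequence is an accumulation point of $(c_j)$. 3. For all $k\geq 0$ we have $b^ka^{-k}b^{-k}a^k=b^{-k}a^kb^ka^{-k}$, and the pair $b,b^{-1}$ with the sequence $(b^ka^{-k}b^{-k}a^k)_k$ gives non-Busemann points; for $k\ge1$ the triples $\{b,b^{-1},b^ka^{-k}b^{-k}a^k\}$ are rigid. 4. The assertions that the pairs and sequences in 1, 2 and 3 give non-Busemann points, and the identity and the rigidity in 3, remain true if $a$ is replaced by $a^{-1}$, or $b$ by $b^{-1}$, or both, throughout, and also if the triples are then multiplied on the left by any $g\in H$. The accumulation points of the sequences $(g\,c_j)_j$, $g\in H$, form an infinite set. 5. For all $m,n,k\in\mathbb Z$ and each choice of sign, the maps $\mathbb N\to H$ ($0\in\mathbb N$), $\gamma^{v,\pm}_{n,k}(t)=[\pm t,n,k]$ and $\gamma^{h,\pm}_{m,n}(t)=[m,n\pm tm,\pm t]$, are geodesic rays. They converge to Busemann points of the metric boundary of $H$, and distinct rays among all of these (both types, all parameters, both signs) have distinct limits. -/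

import Mathlib

open Filter Topology
open scoped BoundedContinuousFunction MatrixGroups

noncomputable section

/-! ### The metric compactification of a metric space -/

section Compactification

variable (X : Type*) [MetricSpace X]

variable {X} in
/-- The bounded continuous function `φ_{y,z}(x) = d(x,y) - d(x,z)`. -/
def distDifference (y z : X) : X →ᵇ ℂ :=
  BoundedContinuousFunction.ofNormedAddCommGroup
    (fun x => ((dist x y - dist x z : ℝ) : ℂ)) (by fun_prop) (dist y z) (by
      intro x
      rw [Complex.norm_real, Real.norm_eq_abs, abs_sub_le_iff]
      have h1 := dist_triangle x z y
      have h2 := dist_triangle x y z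
      rw [dist_comm z y] at h1
      constructor <;> linarith)

/-- The norm-closed (star-)subalgebra of `C_b(X)` generated by the functions vanishing at
infinity, the constants (the subalgebra is unital) and the functions `φ_{y,z}`. -/
def metricAlgebra : StarSubalgebra ℂ (X →ᵇ ℂ) :=
  (StarAlgebra.adjoin ℂ
    ({f : X →ᵇ ℂ | Tendsto f (cocompact X) (𝓝 0)} ∪
      Set.range (fun p : X × X => distDifference p.1 p.2))).topologicalClosure

/-- The metric compactification: the space of characters (the maximal ideal space) of the
commutative C*-algebra `metricAlgebra X`, with the weak-* topology. -/
abbrev MetricCompactification : Type _ :=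
  WeakDual.characterSpace ℂ (metricAlgebra X)

variable {X}

/-- The canonical map from `X` to its metric compactification: `x` acts by evaluation at `x`. -/
def toCompactification (x : X) : MetricCompactification X :=
  ⟨StrongDual.toWeakDual ((BoundedContinuousFunction.evalCLM ℂ x).comp
      (metricAlgebra X).toSubalgebra.toSubmodule.subtypeL), by
    constructor
    · intro h
      have h1 := congrArg (fun φ : WeakDual ℂ (metricAlgebra X) => φ 1) h
      exact one_ne_zero (α := ℂ) h1
    · intro f g
      rfl⟩

variable (X) in
/-- The metric boundary: the points of the compactification outside `X`. -/
def metricBoundary : Set (MetricCompactification X) :=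
  (Set.range (toCompactification (X := X)))ᶜ

/-- The admissible domains of rays: unbounded subsets of `[0, ∞)` containing `0`. -/
structure IsRayDomain (T : Set ℝ) : Prop where
  nonneg : ∀ t ∈ T, 0 ≤ t
  zero_mem : (0 : ℝ) ∈ T
  unbounded : ¬ BddAbove T

/-- Geodesic rays. -/
def IsGeodesicRay {T : Set ℝ} (γ : T → X) : Prop :=
  IsRayDomain T ∧ ∀ s t : T, dist (γ s) (γ t) = |(s : ℝ) - t|

/-- Almost-geodesic rays. -/
def IsAlmostGeodesicRay {T : Set ℝ} (γ : T → X) : Prop :=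
  ∃ hT : IsRayDomain T, ∀ ε : ℝ, 0 < ε → ∃ N : ℕ, ∀ s t : T, (N : ℝ) ≤ s → s ≤ t →
    |dist (γ t) (γ s) + dist (γ s) (γ ⟨0, hT.zero_mem⟩) - t| < ε

variable (X) in
/-- Busemann points: boundary points which are limits of almost-geodesic rays. -/
def busemannPoints : Set (MetricCompactification X) :=
  {ω | ω ∈ metricBoundary X ∧ ∃ (T : Set ℝ) (γ : T → X), IsAlmostGeodesicRay γ ∧
    Tendsto (fun t : T => toCompactification (γ t)) atTop (𝓝 ω)}

variable (X) in
/-- The boundary points which are not Busemann points. -/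
def nonBusemannPoints : Set (MetricCompactification X) :=
  metricBoundary X \ busemannPoints X

/-- The accumulation points in the metric compactification of a sequence in `X`. -/
def limitPoints (c : ℕ → X) : Set (MetricCompactification X) :=
  {ω | MapClusterPt ω atTop (fun j => toCompactification (c j))}

/-- A sequence viewed as a ray with domain `{0, 1, 2, …} ⊆ ℝ`. -/
def natRay (γ : ℕ → X) : Set.range (Nat.cast : ℕ → ℝ) → X :=
  fun t => γ ⌊(t : ℝ)⌋₊

end Compactification

/-! ### Graphs -/

section Graphs

variable {V : Type*} (Γ : SimpleGraph V)

/-- The graph metric of a connected graph. -/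
abbrev graphMetricSpace (h : Γ.Connected) : MetricSpace V where
  dist u v := (Γ.dist u v : ℝ)
  dist_self u := by simp
  dist_comm u v := by rw [Γ.dist_comm]
  dist_triangle u v w := by exact_mod_cast h.dist_triangle
  eq_of_dist_eq_zero {u v} huv := h.dist_eq_zero_iff.mp (by exact_mod_cast huv)

variable {Γ} in
/-- Minimal paths. -/
def IsMinimalPath {u v : V} (p : Γ.Walk u v) : Prop :=
  p.length = Γ.dist u v

variable {Γ} in
/-- Two paths ending at `w` share a tail if they have a common nontrivial terminal segment. -/
def ShareTail {u v w : V} (p : Γ.Walk u w) (q : Γ.Walk v w) : Prop :=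
  ∃ (z : V) (p' : Γ.Walk u z) (q' : Γ.Walk v z) (r : Γ.Walk z w),
    0 < r.length ∧ p = p'.append r ∧ q = q'.append r

/-- No minimal paths `[u, w]` and `[v, w]` share a tail. -/
def NoMinimalPathsShareTail (u v w : V) : Prop :=
  ∀ (p : Γ.Walk u w) (q : Γ.Walk v w), IsMinimalPath p → IsMinimalPath q → ¬ ShareTail p q

/-- The perimeter of a triple of vertices. -/
def perimeter (u v w : V) : ℕ :=
  Γ.dist u v + Γ.dist v w + Γ.dist w u

/-- No minimal paths `[x, y]` and `[x, z]` share a vertex other than `x`. -/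
def MinimalPathsMeetOnlyAt (x y z : V) : Prop :=
  ∀ (p : Γ.Walk x y) (q : Γ.Walk x z), IsMinimalPath p → IsMinimalPath q →
    ∀ w, w ∈ p.support → w ∈ q.support → w = x

/-- Rigid triples. -/
def IsRigidTriple (x y z : V) : Prop :=
  x ≠ y ∧ y ≠ z ∧ x ≠ z ∧ MinimalPathsMeetOnlyAt Γ x y z ∧
    MinimalPathsMeetOnlyAt Γ y x z ∧ MinimalPathsMeetOnlyAt Γ z x y

end Graphs

/-- The Cayley graph of a group with respect to a generating set is connected. -/
theorem mulCayley_connected {G : Type*} [Group G] (S : Set G)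
    (hS : Subgroup.closure S = ⊤) : (SimpleGraph.mulCayley S).Connected := by
  have hadj : ∀ g : G, ∀ s ∈ S, (SimpleGraph.mulCayley S).Reachable g (g * s) := by
    intro g s hs
    by_cases h : g = g * s
    · rw [← h]
    · exact SimpleGraph.Adj.reachable
        ((SimpleGraph.mulCayley_adj' S _ _).2 ⟨h, s, hs, Or.inl rfl⟩)
  have key : ∀ g : G, (SimpleGraph.mulCayley S).Reachable 1 g := by
    intro g
    have hg : g ∈ Subgroup.closure S := by rw [hS]; trivial
    induction hg using Subgroup.closure_induction_right with
    | one => exact SimpleGraph.Reachable.refl _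
    | mul_right x _ y hy ih => exact ih.trans (hadj x y hy)
    | mul_inv_cancel x _ y hy ih =>
      refine ih.trans ?_
      have := (hadj (x * y⁻¹) y hy).symm
      rwa [inv_mul_cancel_right] at this
  have : Nonempty G := ⟨1⟩
  exact SimpleGraph.Connected.mk fun u v => (key u).symm.trans (key v)

/-! ### The discrete Heisenberg group -/

/-- The matrix with rows `(1, m, n)`, `(0, 1, k)`, `(0, 0, 1)`. -/
def heisMatrix (m n k : ℤ) : Matrix (Fin 3) (Fin 3) ℤ :=
  !![1, m, n; 0, 1, k; 0, 0, 1]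

theorem heisMatrix_mul (m n k m' n' k' : ℤ) :
    heisMatrix m n k * heisMatrix m' n' k' = heisMatrix (m + m') (n + n' + m * k') (k + k') := by
  ext i j
  fin_cases i <;> fin_cases j <;>
    simp [heisMatrix, Matrix.mul_apply, Fin.sum_univ_three] <;> ring

theorem heisMatrix_zero : heisMatrix 0 0 0 = 1 := by
  ext i j
  fin_cases i <;> fin_cases j <;> simp [heisMatrix]

/-- The above matrix as an element of the general linear group. -/
def heisGL (m n k : ℤ) : GL (Fin 3) ℤ where
  val := heisMatrix m n k
  inv := heisMatrix (-m) (m * k - n) (-k)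
  val_inv := by rw [heisMatrix_mul, ← heisMatrix_zero]; congr 1 <;> ring
  inv_val := by rw [heisMatrix_mul, ← heisMatrix_zero]; congr 1 <;> ring

theorem heisGL_mul (m n k m' n' k' : ℤ) :
    heisGL m n k * heisGL m' n' k' = heisGL (m + m') (n + n' + m * k') (k + k') :=
  Units.ext (heisMatrix_mul m n k m' n' k')

theorem heisGL_inv (m n k : ℤ) : (heisGL m n k)⁻¹ = heisGL (-m) (m * k - n) (-k) :=
  Units.ext rfl

/-- The discrete Heisenberg group as a subgroup of `GL₃`. -/
def heisenbergSubgroup : Subgroup (GL (Fin 3) ℤ) where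
  carrier := {g | ∃ m n k : ℤ, g = heisGL m n k}
  mul_mem' := by
    rintro _ _ ⟨m, n, k, rfl⟩ ⟨m', n', k', rfl⟩
    exact ⟨_, _, _, heisGL_mul m n k m' n' k'⟩
  one_mem' := ⟨0, 0, 0, Units.ext heisMatrix_zero.symm⟩
  inv_mem' := by
    rintro _ ⟨m, n, k, rfl⟩
    exact ⟨_, _, _, heisGL_inv m n k⟩

/-- The discrete Heisenberg group. (A type of its own, so that it carries only the topology of
the word metric below.) -/
def DiscreteHeisenberg : Type := heisenbergSubgroup

namespace DiscreteHeisenberg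

instance : Group DiscreteHeisenberg := inferInstanceAs (Group heisenbergSubgroup)

/-- The element with matrix rows `(1, m, n)`, `(0, 1, k)`, `(0, 0, 1)`. -/
def mk (m n k : ℤ) : DiscreteHeisenberg :=
  (⟨heisGL m n k, m, n, k, rfl⟩ : heisenbergSubgroup)

/-- The generator `a`. -/
def a : DiscreteHeisenberg := mk 1 0 0

/-- The generator `b`. -/
def b : DiscreteHeisenberg := mk 0 0 1

/-- The set `S = {a, b, a⁻¹, b⁻¹}`. -/
def generators : Set DiscreteHeisenberg := {a, b, a⁻¹, b⁻¹}

theorem mk_mul (m n k m' n' k' : ℤ) :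
    mk m n k * mk m' n' k' = mk (m + m') (n + n' + m * k') (k + k') :=
  Subtype.ext (heisGL_mul m n k m' n' k')

theorem mk_inv (m n k : ℤ) : (mk m n k)⁻¹ = mk (-m) (m * k - n) (-k) :=
  Subtype.ext (heisGL_inv m n k)

theorem one_eq : (1 : DiscreteHeisenberg) = mk 0 0 0 :=
  Subtype.ext (Units.ext heisMatrix_zero.symm)

theorem exists_eq_mk (g : DiscreteHeisenberg) : ∃ m n k : ℤ, g = mk m n k := by
  obtain ⟨_, m, n, k, rfl⟩ := g
  exact ⟨m, n, k, rfl⟩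

theorem closure_generators : Subgroup.closure generators = ⊤ := by
  have ha : a ∈ Subgroup.closure generators := Subgroup.subset_closure (by simp [generators])
  have hb : b ∈ Subgroup.closure generators := Subgroup.subset_closure (by simp [generators])
  have haz : ∀ m : ℤ, a ^ m = mk m 0 0 := by
    intro m
    induction m using Int.induction_on with
    | zero => rw [zpow_zero, one_eq]
    | succ i ih => rw [zpow_add_one, ih, a, mk_mul]; congr 1
    | pred i ih => rw [zpow_sub_one, ih, a, mk_inv, mk_mul]; congr 1; ring
  have hbz : ∀ k : ℤ, b ^ k = mk 0 0 k := by
    intro k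
    induction k using Int.induction_on with
    | zero => rw [zpow_zero, one_eq]
    | succ i ih => rw [zpow_add_one, ih, b, mk_mul]; congr 1
    | pred i ih => rw [zpow_sub_one, ih, b, mk_inv, mk_mul]; congr 1
  rw [eq_top_iff]
  intro g _
  obtain ⟨m, n, k, rfl⟩ := exists_eq_mk g
  have h : mk m n k = b ^ (k - 1) * (a ^ n * b * a ^ (m - n)) := by
    rw [haz, haz, hbz, b, mk_mul, mk_mul, mk_mul]; congr 1 <;> ring
  rw [h]
  exact mul_mem (zpow_mem hb _) (mul_mem (mul_mem (zpow_mem ha _) hb) (zpow_mem ha _))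

/-- The Cayley graph (edges join `g` and `g * s` for `s ∈ S`). -/
def cayleyGraph : SimpleGraph DiscreteHeisenberg := SimpleGraph.mulCayley generators

theorem cayleyGraph_connected : cayleyGraph.Connected :=
  mulCayley_connected generators closure_generators

/-- The discrete Heisenberg group carries the path metric of its Cayley graph. -/
instance : MetricSpace DiscreteHeisenberg :=
  graphMetricSpace cayleyGraph cayleyGraph_connected

/-- The successive vertices of the path starting at `g` which is spelled out by a word. -/
def trace (g : DiscreteHeisenberg) (w : List DiscreteHeisenberg) : List DiscreteHeisenberg :=
  w.scanl (· * ·) g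

/-- The word `w` labels a minimal path from `g` to `h`, and this is the only minimal path. -/
def IsUniqueMinimalPath (g h : DiscreteHeisenberg) (w : List DiscreteHeisenberg) : Prop :=
  ∀ p : cayleyGraph.Walk g h, IsMinimalPath p ↔ p.support = trace g w

/-- The triples `{u, v, c j}`, `j ≥ 1`, have no minimal paths `[u, c j]`, `[v, c j]` with a common
tail and have unbounded perimeter, and they give rise to non-Busemann points: the sequence
`c` accumulates on the metric boundary, and only at non-Busemann points. -/
structure GiveNonBusemannPoints (u v : DiscreteHeisenberg) (c : ℕ → DiscreteHeisenberg) :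
    Prop where
  noTail : ∀ j, 1 ≤ j → NoMinimalPathsShareTail cayleyGraph u v (c j)
  perimeter_tendsto : Tendsto (fun j => perimeter cayleyGraph u v (c j)) atTop atTop
  nonempty : (limitPoints c).Nonempty
  nonBusemann : limitPoints c ⊆ nonBusemannPoints DiscreteHeisenberg

/-- The rays `t ↦ (1, ±t, n; 0, 1, k; 0, 0, 1)`. -/
def verticalRay (n k : ℤ) (ε : ℤˣ) (t : ℕ) : DiscreteHeisenberg :=
  mk (ε * t) n k

/-- The rays `t ↦ (1, m, n ± t m; 0, 1, ±t; 0, 0, 1)`. -/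
def horizontalRay (m n : ℤ) (ε : ℤˣ) (t : ℕ) : DiscreteHeisenberg :=
  mk m (n + ε * (t * m)) (ε * t)

/-- All of these rays as one family. -/
def ray : (ℤ × ℤ × ℤˣ) ⊕ (ℤ × ℤ × ℤˣ) → ℕ → DiscreteHeisenberg
  | Sum.inl (n, k, ε) => verticalRay n k ε
  | Sum.inr (m, n, ε) => horizontalRay m n ε

end DiscreteHeisenberg

end

/-! Distances in a graph are integers, so two points whose values of φ_{y,z} are both within 1/2 of
the value at a point of the compactification have equal values. On a tail of an almost-geodesic ray
the distances to the starting point therefore add up exactly. If the limit of such a ray is also an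
accumulation point of (c_j), comparing values of φ gives one point p of the ray that lies between u
and c_j and between v and c_j for infinitely many j (`exists_frequently_of_busemannPoint`). When no
neighbour of c_j is closer both to u and to v (`NoCommonPredecessor`), this forces p = c_j
infinitely often, which is absurd for distinct c_j. Accumulation points exist by compactness and lie
in the boundary because indicators of points vanish at infinity. The same combinatorial condition
rules out shared tails.

What remains is word length in H. Along a path from e the coordinate n is a signed area: a step
b^{±1} taken at first coordinate m changes n by ±m. Bounding the area by the range of the first
coordinate and the number of vertical steps gives `exists_bounds`. It has two uses. A length below
|m| + |k| + 2 forces n to lie between 0 and mk (`between_of_len_lt`), which settles the families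
built from long powers of b. And [0,k²,0] has length at least 4k by the inequality between
arithmetic and geometric means; it is spelled by words of length 4k beginning with b and with b⁻¹,
so b and b⁻¹ are both within 4k - 1 of it, and the estimate excludes common predecessors and gives
rigidity.

Left translations and sign changes of a and b are graph automorphisms, so each family is treated
once. Limits are told apart by one function φ_{y,z}. For a geodesic ray, d(γ(t),y) - t is decreasing
and bounded below, hence every function of the algebra converges along γ. -/

noncomputable section

/-! ### Boundary points, Busemann points and limits of geodesic rays -/

section CompactificationLemmas

variable {X : Type*} [MetricSpace X]

theorem distDifference_apply (y z x : X) :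
    distDifference y z x = ((dist x y - dist x z : ℝ) : ℂ) := rfl

theorem distDifference_mem (y z : X) : distDifference y z ∈ metricAlgebra X :=
  StarSubalgebra.le_topologicalClosure _
    (StarAlgebra.subset_adjoin ℂ _ (Or.inr ⟨(y, z), rfl⟩))

theorem mem_metricAlgebra_of_tendsto_zero {f : X →ᵇ ℂ} (hf : Tendsto f (cocompact X) (𝓝 0)) :
    f ∈ metricAlgebra X :=
  StarSubalgebra.le_topologicalClosure _ (StarAlgebra.subset_adjoin ℂ _ (Or.inl hf))

theorem toCompactification_apply (x : X) (f : metricAlgebra X) :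
    toCompactification x f = (f : X →ᵇ ℂ) x := rfl

theorem continuous_compactification_apply (f : metricAlgebra X) :
    Continuous fun ω : MetricCompactification X => ω f :=
  (WeakDual.eval_continuous f).comp continuous_subtype_val

instance : CompleteSpace (metricAlgebra X) :=
  (StarSubalgebra.isClosed_topologicalClosure _ :
    IsClosed (metricAlgebra X : Set (X →ᵇ ℂ))).isComplete.completeSpace_coe

instance : CompactSpace (MetricCompactification X) := inferInstance

theorem limitPoints_nonempty (c : ℕ → X) : (limitPoints c).Nonempty :=
  exists_clusterPt_of_compactSpace _

/-- The values of `φ_{y,z}` are eventually close to the value at a point of the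
compactification. -/
theorem eventually_norm_distDifference_lt (ω : MetricCompactification X) (y z : X) :
    ∀ᶠ ω' : MetricCompactification X in 𝓝 ω,
      ‖ω' ⟨distDifference y z, distDifference_mem y z⟩ -
        ω ⟨distDifference y z, distDifference_mem y z⟩‖ < 1 / 2 := by
  have h := (continuous_compactification_apply
    (⟨distDifference y z, distDifference_mem y z⟩ : metricAlgebra X)).tendsto ω
  have h2 := (Metric.tendsto_nhds.1 h) (1 / 2) (by norm_num)
  simpa only [dist_eq_norm] using h2

theorem tendsto_mem_metricBoundary [DiscreteTopology X] {ι : Type*} {l : Filter ι} {c : ι → X}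
    (hc : Tendsto c l cofinite) {ω : MetricCompactification X}
    (hω : MapClusterPt ω l fun j => toCompactification (c j)) : ω ∈ metricBoundary X := by
  classical
  rintro ⟨x, rfl⟩
  let f : X →ᵇ ℂ := BoundedContinuousFunction.ofNormedAddCommGroupDiscrete
    (fun y => if y = x then 1 else 0) 1 (by intro y; split_ifs <;> simp)
  have hfx : ∀ y, f y = if y = x then 1 else 0 := fun y => rfl
  have hf : Tendsto f (cocompact X) (𝓝 0) := by
    rw [cocompact_eq_cofinite]
    refine tendsto_const_nhds.congr' ?_
    have : ∀ᶠ y in cofinite, y ≠ x := (Set.finite_singleton x).compl_mem_cofinite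
    filter_upwards [this] with y hy
    rw [hfx, if_neg hy]
  have h := (continuous_compactification_apply
    (⟨f, mem_metricAlgebra_of_tendsto_zero hf⟩ : metricAlgebra X)).tendsto (toCompactification x)
  have h2 := (Metric.tendsto_nhds.1 h) 1 one_pos
  have h3 := hω.frequently h2
  have h4 : ∀ᶠ j in l, c j ≠ x := hc.eventually (Set.finite_singleton x).compl_mem_cofinite
  obtain ⟨j, hj, hj'⟩ := (h3.and_eventually h4).exists
  rw [toCompactification_apply, toCompactification_apply] at hj
  simp only [hfx, if_neg hj', if_true, dist_eq_norm] at hj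
  norm_num at hj

/-- The distances are integers. -/
def HasIntegerDist (X : Type*) [MetricSpace X] : Prop := ∀ x y : X, ∃ n : ℤ, dist x y = n

theorem HasIntegerDist.sub_eq_of_norm_lt (hX : HasIntegerDist X) {x y z x' : X} {w : ℂ}
    (h : ‖distDifference y z x - w‖ < 1 / 2) (h' : ‖distDifference y z x' - w‖ < 1 / 2) :
    dist x y - dist x z = dist x' y - dist x' z := by
  have h1 : ‖distDifference y z x - distDifference y z x'‖ < 1 := by
    have := norm_sub_le (distDifference y z x - w) (distDifference y z x' - w)
    rw [sub_sub_sub_cancel_right] at this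
    linarith
  rw [distDifference_apply, distDifference_apply, ← Complex.ofReal_sub, Complex.norm_real,
    Real.norm_eq_abs] at h1
  obtain ⟨n1, e1⟩ := hX x y
  obtain ⟨n2, e2⟩ := hX x z
  obtain ⟨n3, e3⟩ := hX x' y
  obtain ⟨n4, e4⟩ := hX x' z
  rw [e1, e2, e3, e4] at h1 ⊢
  have h2 : |(n1 - n2) - (n3 - n4)| < 1 := by exact_mod_cast h1
  rw [Int.abs_lt_one_iff] at h2
  have h3 : n1 - n2 = n3 - n4 := by lia
  exact_mod_cast h3

/-- A value of `φ_{y,z}` taken eventually along one family is taken frequently along any other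
family with a common accumulation point. -/
theorem HasIntegerDist.frequently_eq (hX : HasIntegerDist X) {ι κ : Type*} {l : Filter ι}
    {l' : Filter κ} {c : ι → X} {c' : κ → X} {ω : MetricCompactification X}
    (hc : MapClusterPt ω l fun j => toCompactification (c j))
    (hc' : MapClusterPt ω l' fun j => toCompactification (c' j)) {y z : X} {q : ℝ}
    (hq : ∀ᶠ j in l', dist (c' j) y - dist (c' j) z = q) :
    ∃ᶠ j in l, dist (c j) y - dist (c j) z = q := by
  have h := eventually_norm_distDifference_lt ω y z
  obtain ⟨j', h1, h2⟩ := ((hc'.frequently h).and_eventually hq).exists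
  refine (hc.frequently h).mono fun j hj => ?_
  rw [← h2]
  exact hX.sub_eq_of_norm_lt hj h1

/-- With o the start of the ray and s far out, φ_{u,o} agrees at c_j and at γ(s), while
φ_{γ(s),o}(c_j) = -d(γ(s),o) by additivity along the ray. Subtracting eliminates o and leaves
d(c_j,u) = d(c_j,γ(s)) + d(γ(s),u); the same p = γ(s) serves v. -/
theorem exists_frequently_of_busemannPoint (hX : HasIntegerDist X) {c : ℕ → X}
    {ω : MetricCompactification X} (hω : ω ∈ busemannPoints X) (hc : ω ∈ limitPoints c)
    (u v : X) : ∃ p, ∃ᶠ j in atTop, dist (c j) u = dist (c j) p + dist p u ∧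
      dist (c j) v = dist (c j) p + dist p v := by
  obtain ⟨-, T, γ, ⟨hT, hγ⟩, hlim⟩ := hω
  have : Nonempty T := ⟨⟨0, hT.zero_mem⟩⟩
  set o : X := γ ⟨0, hT.zero_mem⟩ with ho
  -- The defining estimate for (s,t) and for (t,t) places two integers within 1/4 of the same number
  -- t, so they coincide.
  obtain ⟨N, hN⟩ := hγ (1 / 4) (by norm_num)
  have hadd : ∀ s t : T, (N : ℝ) ≤ s → s ≤ t →
      dist (γ t) (γ s) + dist (γ s) o = dist (γ t) o := by
    intro s t hs hst
    have h1 := hN s t hs hst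
    have h2 := hN t t (hs.trans hst) le_rfl
    rw [dist_self, zero_add] at h2
    obtain ⟨n1, e1⟩ := hX (γ t) (γ s)
    obtain ⟨n2, e2⟩ := hX (γ s) o
    obtain ⟨n3, e3⟩ := hX (γ t) o
    rw [e1, e2] at h1 ⊢
    rw [e3] at h2 ⊢
    rw [abs_lt] at h1 h2
    have h3 : n1 + n2 < n3 + 1 := by
      have : (n1 : ℝ) + n2 < n3 + 1 := by linarith
      exact_mod_cast this
    have h4 : n3 < n1 + n2 + 1 := by
      have : (n3 : ℝ) < n1 + n2 + 1 := by linarith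
      exact_mod_cast this
    have h5 : n1 + n2 = n3 := by lia
    exact_mod_cast h5
  obtain ⟨x, hxT, hx⟩ := not_bddAbove_iff.1 hT.unbounded N
  obtain ⟨s, hsN, hsu, hsv⟩ := ((eventually_ge_atTop (⟨x, hxT⟩ : T)).and
    ((hlim.eventually (eventually_norm_distDifference_lt ω u o)).and
      (hlim.eventually (eventually_norm_distDifference_lt ω v o)))).exists
  have hsN' : (N : ℝ) ≤ s := hx.le.trans hsN
  -- A second point of the ray, chosen after s: the test function φ_{γ(s),o} itself depends on s.
  obtain ⟨t, hst, ht⟩ := ((eventually_ge_atTop s).and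
    (hlim.eventually (eventually_norm_distDifference_lt ω (γ s) o))).exists
  refine ⟨γ s, (MapClusterPt.frequently hc ((eventually_norm_distDifference_lt ω u o).and
    ((eventually_norm_distDifference_lt ω v o).and
      (eventually_norm_distDifference_lt ω (γ s) o)))).mono ?_⟩
  rintro j ⟨hju, hjv, hjs⟩
  have e1 := hX.sub_eq_of_norm_lt hju hsu
  have e2 := hX.sub_eq_of_norm_lt hjv hsv
  have e3 := hX.sub_eq_of_norm_lt hjs ht
  have e4 := hadd s t hsN' hst
  constructor <;> linarith

/-- The functions of the metric algebra converge along a geodesic sequence. -/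
theorem exists_tendsto_of_mem_metricAlgebra [DiscreteTopology X] {γ : ℕ → X}
    (hγ : ∀ s t, dist (γ s) (γ t) = |(s : ℝ) - t|) (hcof : Tendsto γ atTop cofinite)
    {f : X →ᵇ ℂ} (hf : f ∈ metricAlgebra X) :
    ∃ l, Tendsto (fun t => f (γ t)) atTop (𝓝 l) := by
  have hconv : ∀ y, ∃ l, Tendsto (fun t : ℕ => dist (γ t) y - t) atTop (𝓝 l) := by
    intro y
    refine ⟨_, tendsto_atTop_ciInf ?_ ?_⟩
    · refine antitone_nat_of_succ_le fun t => ?_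
      have h1 := dist_triangle (γ (t + 1)) (γ t) y
      rw [hγ] at h1
      push_cast at h1 ⊢
      rw [add_sub_cancel_left, abs_one] at h1
      linarith
    · refine ⟨-dist (γ 0) y, ?_⟩
      rintro _ ⟨t, rfl⟩
      have h1 := dist_triangle (γ t) y (γ 0)
      rw [hγ, dist_comm y] at h1
      simp only [Nat.cast_zero, sub_zero, Nat.abs_cast] at h1
      dsimp only
      linarith
  have hadj : ∀ f ∈ StarAlgebra.adjoin ℂ
      ({f : X →ᵇ ℂ | Tendsto f (cocompact X) (𝓝 0)} ∪
        Set.range (fun p : X × X => distDifference p.1 p.2)),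
      ∃ l, Tendsto (fun t => f (γ t)) atTop (𝓝 l) := by
    intro f hf
    induction hf using StarAlgebra.adjoin_induction with
    | mem f h =>
      rcases h with h | ⟨⟨y, z⟩, rfl⟩
      · rw [Set.mem_ofPred_eq, cocompact_eq_cofinite] at h
        exact ⟨0, h.comp hcof⟩
      · obtain ⟨l1, h1⟩ := hconv y
        obtain ⟨l2, h2⟩ := hconv z
        refine ⟨((l1 - l2 : ℝ) : ℂ), ?_⟩
        refine ((Complex.continuous_ofReal.tendsto _).comp (h1.sub h2)).congr fun t => ?_
        simp [distDifference_apply]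
    | algebraMap r => exact ⟨r, tendsto_const_nhds⟩
    | add f g _ _ h1 h2 =>
      obtain ⟨l1, h1⟩ := h1
      obtain ⟨l2, h2⟩ := h2
      exact ⟨_, h1.add h2⟩
    | mul f g _ _ h1 h2 =>
      obtain ⟨l1, h1⟩ := h1
      obtain ⟨l2, h2⟩ := h2
      exact ⟨_, h1.mul h2⟩
    | star f _ h1 =>
      obtain ⟨l1, h1⟩ := h1
      exact ⟨_, h1.star⟩
  -- Convergence passes to uniform limits by the usual ε/3 argument.
  apply cauchySeq_tendsto_of_complete
  rw [Metric.cauchySeq_iff]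
  intro ε hε
  obtain ⟨g, hg, hfg⟩ := Metric.mem_closure_iff.1 hf (ε / 3) (by linarith)
  obtain ⟨l, hl⟩ := hadj g hg
  obtain ⟨N, hN⟩ := Metric.cauchySeq_iff.1 hl.cauchySeq (ε / 3) (by linarith)
  refine ⟨N, fun m hm n hn => ?_⟩
  have h1 := BoundedContinuousFunction.dist_coe_le_dist (f := f) (g := g) (γ m)
  have h2 := BoundedContinuousFunction.dist_coe_le_dist (f := f) (g := g) (γ n)
  have h3 := dist_triangle4 (f (γ m)) (g (γ m)) (g (γ n)) (f (γ n))
  have h4 := hN m hm n hn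
  rw [dist_comm (g (γ n))] at h3
  linarith

theorem exists_tendsto_toCompactification [DiscreteTopology X] {γ : ℕ → X}
    (hγ : ∀ s t, dist (γ s) (γ t) = |(s : ℝ) - t|) (hcof : Tendsto γ atTop cofinite) :
    ∃ ω, Tendsto (fun t => toCompactification (γ t)) atTop (𝓝 ω) := by
  obtain ⟨ω, hω⟩ := limitPoints_nonempty γ
  refine ⟨ω, ?_⟩
  rw [tendsto_subtype_rng]
  refine tendsto_iff_forall_eval_tendsto_topDualPairing.2 fun f => ?_
  obtain ⟨l, hl⟩ := exists_tendsto_of_mem_metricAlgebra hγ hcof f.2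
  -- Compactness only gives an accumulation point ω; since f(γ(t)) converges, its limit must be
  -- ω(f), so the whole sequence tends to ω.
  have h : MapClusterPt (ω f) atTop fun t => (f : X →ᵇ ℂ) (γ t) :=
    MapClusterPt.continuousAt_comp (f := fun ω : MetricCompactification X => ω f)
      (continuous_compactification_apply f).continuousAt hω
  have hl' : ω f = l := by
    have : (𝓝 (ω f) ⊓ 𝓝 l).NeBot := ClusterPt.neBot (h.clusterPt.mono hl)
    exact eq_of_nhds_neBot this
  exact hl'.symm ▸ hl

theorem isRayDomain_range_natCast : IsRayDomain (Set.range (Nat.cast : ℕ → ℝ)) where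
  nonneg := by rintro _ ⟨n, rfl⟩; exact n.cast_nonneg
  zero_mem := ⟨0, Nat.cast_zero⟩
  unbounded := not_bddAbove_iff.2 fun x => by
    obtain ⟨n, hn⟩ := exists_nat_gt x
    exact ⟨n, ⟨n, rfl⟩, hn⟩

theorem isGeodesicRay_natRay {γ : ℕ → X} (hγ : ∀ s t, dist (γ s) (γ t) = |(s : ℝ) - t|) :
    IsGeodesicRay (natRay γ) := by
  refine ⟨isRayDomain_range_natCast, ?_⟩
  rintro ⟨_, s, rfl⟩ ⟨_, t, rfl⟩
  simp only [natRay, Nat.floor_natCast, hγ]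

theorem IsGeodesicRay.isAlmostGeodesicRay {T : Set ℝ} {γ : T → X} (hγ : IsGeodesicRay γ) :
    IsAlmostGeodesicRay γ := by
  refine ⟨hγ.1, fun ε hε => ⟨0, fun s t hs hst => ?_⟩⟩
  have hst' : (s : ℝ) ≤ t := hst
  rw [hγ.2, hγ.2, abs_of_nonneg (sub_nonneg.2 hst'), sub_zero, abs_of_nonneg (hγ.1.nonneg s s.2)]
  simpa using hε

theorem mem_busemannPoints_of_tendsto [DiscreteTopology X] {γ : ℕ → X}
    (hγ : ∀ s t, dist (γ s) (γ t) = |(s : ℝ) - t|) (hcof : Tendsto γ atTop cofinite)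
    {ω : MetricCompactification X}
    (hω : Tendsto (fun t => toCompactification (γ t)) atTop (𝓝 ω)) : ω ∈ busemannPoints X := by
  refine ⟨tendsto_mem_metricBoundary hcof hω.mapClusterPt, _, natRay γ,
    (isGeodesicRay_natRay hγ).isAlmostGeodesicRay, ?_⟩
  have hfloor : Tendsto (fun t : Set.range (Nat.cast : ℕ → ℝ) => ⌊(t : ℝ)⌋₊) atTop atTop := by
    refine tendsto_atTop.2 fun n => ?_
    filter_upwards [eventually_ge_atTop (⟨n, n, rfl⟩ : Set.range (Nat.cast : ℕ → ℝ))] with t ht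
    exact Nat.le_floor ht
  exact hω.comp hfloor

end CompactificationLemmas

/-! ### Common predecessors and minimal paths in graphs -/

section GraphLemmas

variable {V W : Type*} {Γ : SimpleGraph V} {Δ : SimpleGraph W}

/-- No neighbour of `w` lies on minimal paths from both `u` and `v` to `w`. -/
def NoCommonPredecessor (Γ : SimpleGraph V) (u v w : V) : Prop :=
  ∀ p, Γ.Adj p w → ¬ (Γ.dist u p + 1 = Γ.dist u w ∧ Γ.dist v p + 1 = Γ.dist v w)

/-- If p ≠ w, the neighbour of w on a minimal path from w to p lies on minimal paths from both u and
v to w. -/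
theorem NoCommonPredecessor.eq_of_dist_add (hΓ : Γ.Connected) {u v w p : V}
    (h : NoCommonPredecessor Γ u v w) (hu : Γ.dist u p + Γ.dist p w = Γ.dist u w)
    (hv : Γ.dist v p + Γ.dist p w = Γ.dist v w) : p = w := by
  by_contra hne
  obtain ⟨r, hr⟩ := hΓ.exists_walk_length_eq_dist w p
  cases r with
  | nil => exact hne rfl
  | @cons _ q _ hq r =>
    have h1 : Γ.dist w q = 1 := SimpleGraph.dist_eq_one_iff_adj.2 hq
    have h2 := SimpleGraph.dist_le r
    rw [SimpleGraph.Walk.length_cons, Γ.dist_comm] at hr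
    rw [Γ.dist_comm] at h1 h2
    have h3 : Γ.dist u q ≤ Γ.dist u p + Γ.dist p q := hΓ.dist_triangle
    have h4 : Γ.dist v q ≤ Γ.dist v p + Γ.dist p q := hΓ.dist_triangle
    have h5 : Γ.dist u w ≤ Γ.dist u q + Γ.dist q w := hΓ.dist_triangle
    have h6 : Γ.dist v w ≤ Γ.dist v q + Γ.dist q w := hΓ.dist_triangle
    exact h q hq.symm ⟨by lia, by lia⟩

theorem IsMinimalPath.dist_add_dist (hΓ : Γ.Connected) {u v w : V} {p : Γ.Walk u v}
    (hp : IsMinimalPath p) (hw : w ∈ p.support) :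
    Γ.dist u w + Γ.dist w v = Γ.dist u v := by
  classical
  have h1 := congrArg SimpleGraph.Walk.length (p.take_spec hw)
  rw [SimpleGraph.Walk.length_append, hp] at h1
  have h2 := SimpleGraph.dist_le (p.takeUntil w hw)
  have h3 := SimpleGraph.dist_le (p.dropUntil w hw)
  have h4 : Γ.dist u v ≤ Γ.dist u w + Γ.dist w v := hΓ.dist_triangle
  lia

theorem NoCommonPredecessor.noMinimalPathsShareTail (hΓ : Γ.Connected) {u v w : V}
    (h : NoCommonPredecessor Γ u v w) : NoMinimalPathsShareTail Γ u v w := by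
  rintro p q hp hq ⟨z, p', q', r, hr, rfl, rfl⟩
  have h1 := hp.dist_add_dist hΓ (w := z) (by simp)
  have h2 := hq.dist_add_dist hΓ (w := z) (by simp)
  obtain rfl := h.eq_of_dist_add hΓ h1 h2
  have h3 := SimpleGraph.dist_le p'
  have h4 : p'.length + r.length = _ := (SimpleGraph.Walk.length_append p' r).symm.trans hp
  lia

theorem dist_hom_le (hΓ : Γ.Connected) (φ : Γ →g Δ) (u v : V) :
    Δ.dist (φ u) (φ v) ≤ Γ.dist u v := by
  obtain ⟨p, hp⟩ := hΓ.exists_walk_length_eq_dist u v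
  rw [← hp, ← p.length_map φ]
  exact SimpleGraph.dist_le _

theorem dist_iso (hΓ : Γ.Connected) (φ : Γ ≃g Δ) (u v : V) :
    Δ.dist (φ u) (φ v) = Γ.dist u v := by
  refine le_antisymm (dist_hom_le hΓ φ.toHom u v) ?_
  simpa using dist_hom_le (φ.connected_iff.1 hΓ) φ.symm.toHom (φ u) (φ v)

theorem NoCommonPredecessor.map (hΓ : Γ.Connected) (φ : Γ ≃g Δ) {u v w : V}
    (h : NoCommonPredecessor Γ u v w) :
    NoCommonPredecessor Δ (φ u) (φ v) (φ w) := by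
  intro p hp
  obtain ⟨p, rfl⟩ := φ.surjective p
  simp only [dist_iso hΓ φ]
  exact h p (φ.map_adj_iff.1 hp)

/-- Restated by distances alone, the condition is visibly invariant under graph isomorphisms and
accessible to length computations. -/
theorem minimalPathsMeetOnlyAt_iff (hΓ : Γ.Connected) {x y z : V} :
    MinimalPathsMeetOnlyAt Γ x y z ↔ ∀ w, Γ.dist x w + Γ.dist w y = Γ.dist x y →
      Γ.dist x w + Γ.dist w z = Γ.dist x z → w = x := by
  constructor
  · intro h w hy hz
    obtain ⟨p, hp⟩ := hΓ.exists_walk_length_eq_dist x w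
    obtain ⟨q, hq⟩ := hΓ.exists_walk_length_eq_dist w y
    obtain ⟨r, hr⟩ := hΓ.exists_walk_length_eq_dist w z
    exact h (p.append q) (p.append r)
      (by rw [IsMinimalPath, SimpleGraph.Walk.length_append, hp, hq, hy])
      (by rw [IsMinimalPath, SimpleGraph.Walk.length_append, hp, hr, hz]) w (by simp) (by simp)
  · intro h p q hp hq w hwp hwq
    exact h w (hp.dist_add_dist hΓ hwp) (hq.dist_add_dist hΓ hwq)

theorem MinimalPathsMeetOnlyAt.map (hΓ : Γ.Connected) (φ : Γ ≃g Δ) {x y z : V}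
    (h : MinimalPathsMeetOnlyAt Γ x y z) : MinimalPathsMeetOnlyAt Δ (φ x) (φ y) (φ z) := by
  rw [minimalPathsMeetOnlyAt_iff hΓ] at h
  rw [minimalPathsMeetOnlyAt_iff (φ.connected_iff.1 hΓ)]
  intro w
  obtain ⟨w, rfl⟩ := φ.surjective w
  simp only [dist_iso hΓ φ]
  exact fun hy hz => congrArg φ (h w hy hz)

theorem NoCommonPredecessor.minimalPathsMeetOnlyAt (hΓ : Γ.Connected) {u v w : V}
    (h : NoCommonPredecessor Γ u v w) : MinimalPathsMeetOnlyAt Γ w u v := by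
  refine (minimalPathsMeetOnlyAt_iff hΓ).2 fun z h1 h2 => ?_
  rw [add_comm, SimpleGraph.dist_comm, SimpleGraph.dist_comm (u := w) (v := z),
    SimpleGraph.dist_comm (u := w)] at h1 h2
  exact h.eq_of_dist_add hΓ h1 h2

theorem perimeter_map (hΓ : Γ.Connected) (φ : Γ ≃g Δ) (u v w : V) :
    perimeter Δ (φ u) (φ v) (φ w) = perimeter Γ u v w := by
  simp only [perimeter, dist_iso hΓ φ]

end GraphLemmas

/-! ### Coordinates, edges and symmetries of the Cayley graph -/

namespace DiscreteHeisenberg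

/-- The coordinates of `mk m n k`. -/
def coords (g : DiscreteHeisenberg) : ℤ × ℤ × ℤ :=
  let A : Matrix (Fin 3) (Fin 3) ℤ := (show heisenbergSubgroup from g).1.val
  (A 0 1, A 0 2, A 1 2)

theorem coords_mk (m n k : ℤ) : coords (mk m n k) = (m, n, k) := rfl

theorem mk_inj {m n k m' n' k' : ℤ} : mk m n k = mk m' n' k' ↔ m = m' ∧ n = n' ∧ k = k' := by
  refine ⟨fun h => ?_, by rintro ⟨rfl, rfl, rfl⟩; rfl⟩
  simpa [coords_mk] using congrArg coords h

theorem a_inv : a⁻¹ = mk (-1) 0 0 := by simp [a, mk_inv]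

theorem b_inv : b⁻¹ = mk 0 0 (-1) := by simp [b, mk_inv]

theorem mem_generators_mk {m n k : ℤ} :
    mk m n k ∈ generators ↔ n = 0 ∧ (m = 0 ∧ |k| = 1 ∨ k = 0 ∧ |m| = 1) := by
  simp only [generators, Set.mem_insert_iff, Set.mem_singleton_iff, a_inv, b_inv]
  simp only [a, b, mk_inj]
  grind

theorem adj_iff {g h : DiscreteHeisenberg} : cayleyGraph.Adj g h ↔ g⁻¹ * h ∈ generators := by
  have hinv : ∀ s ∈ generators, s⁻¹ ∈ generators := by
    intro s hs
    simp only [generators, Set.mem_insert_iff, Set.mem_singleton_iff] at hs ⊢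
    rcases hs with rfl | rfl | rfl | rfl <;> simp
  rw [cayleyGraph, SimpleGraph.mulCayley_adj']
  constructor
  · rintro ⟨-, s, hs, rfl | rfl⟩
    · simpa using hs
    · simpa using hinv s hs
  · intro h1
    refine ⟨?_, _, h1, Or.inl (by group)⟩
    rintro rfl
    rw [inv_mul_cancel, one_eq, mem_generators_mk] at h1
    simp at h1

theorem exists_of_adj {g h : DiscreteHeisenberg} (hgh : cayleyGraph.Adj g h) :
    ∃ s : ℤˣ, h = g * mk s 0 0 ∨ h = g * mk 0 0 s := by
  rw [adj_iff] at hgh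
  obtain ⟨m, n, k, e⟩ := exists_eq_mk (g⁻¹ * h)
  have e' : h = g * mk m n k := by rw [← e]; group
  rw [e, mem_generators_mk] at hgh
  obtain ⟨rfl, ⟨rfl, hk⟩ | ⟨rfl, hm⟩⟩ := hgh
  · exact ⟨(Int.isUnit_iff_abs_eq.2 hk).unit, Or.inr e'⟩
  · exact ⟨(Int.isUnit_iff_abs_eq.2 hm).unit, Or.inl e'⟩

/-- The word length of `mk m n k`. -/
def len (m n k : ℤ) : ℤ := cayleyGraph.dist 1 (mk m n k)

/-- The automorphism with `a ↦ a ^ α`, `b ↦ b ^ β`. -/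
def signEquiv (α β : ℤˣ) : DiscreteHeisenberg ≃* DiscreteHeisenberg where
  toFun g := mk (α * (coords g).1) (α * β * (coords g).2.1) (β * (coords g).2.2)
  invFun g := mk (α * (coords g).1) (α * β * (coords g).2.1) (β * (coords g).2.2)
  left_inv g := by
    obtain ⟨m, n, k, rfl⟩ := exists_eq_mk g
    rcases Int.units_eq_one_or α with rfl | rfl <;>
      rcases Int.units_eq_one_or β with rfl | rfl <;> simp [coords_mk]
  right_inv g := by
    obtain ⟨m, n, k, rfl⟩ := exists_eq_mk g
    rcases Int.units_eq_one_or α with rfl | rfl <;>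
      rcases Int.units_eq_one_or β with rfl | rfl <;> simp [coords_mk]
  map_mul' g h := by
    obtain ⟨m, n, k, rfl⟩ := exists_eq_mk g
    obtain ⟨m', n', k', rfl⟩ := exists_eq_mk h
    simp only [mk_mul, coords_mk, mk_inj]
    refine ⟨by ring, by ring, by ring⟩

theorem signEquiv_mk (α β : ℤˣ) (m n k : ℤ) :
    signEquiv α β (mk m n k) = mk (α * m) (α * β * n) (β * k) := rfl

/-- The isometry `h ↦ g * signEquiv α β h` of the Cayley graph. -/
def cayleyIso (α β : ℤˣ) (g : DiscreteHeisenberg) : cayleyGraph ≃g cayleyGraph where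
  toEquiv := (signEquiv α β).toEquiv.trans (Equiv.mulLeft g)
  map_rel_iff' {x y} := by
    have h : (g * signEquiv α β x)⁻¹ * (g * signEquiv α β y) = signEquiv α β (x⁻¹ * y) := by
      rw [map_mul, map_inv]; group
    change cayleyGraph.Adj (g * signEquiv α β x) (g * signEquiv α β y) ↔ _
    rw [adj_iff, adj_iff, h]
    obtain ⟨m, n, k, e⟩ := exists_eq_mk (x⁻¹ * y)
    rw [e, signEquiv_mk, mem_generators_mk, mem_generators_mk]
    rcases Int.units_eq_one_or α with rfl | rfl <;>
      rcases Int.units_eq_one_or β with rfl | rfl <;> simp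

theorem cayleyIso_apply (α β : ℤˣ) (g h : DiscreteHeisenberg) :
    cayleyIso α β g h = g * signEquiv α β h := rfl

theorem dist_mul_left (g x y : DiscreteHeisenberg) :
    cayleyGraph.dist (g * x) (g * y) = cayleyGraph.dist x y := by
  have h := dist_iso cayleyGraph_connected (cayleyIso 1 1 g) x y
  have h1 : ∀ x, signEquiv 1 1 x = x := by
    intro x
    obtain ⟨m, n, k, rfl⟩ := exists_eq_mk x
    simp [signEquiv_mk]
  simpa only [cayleyIso_apply, h1] using h

/-! ### Estimates for the word length -/

theorem dist_mk (m n k m' n' k' : ℤ) :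
    (cayleyGraph.dist (mk m n k) (mk m' n' k') : ℤ) =
      len (m' - m) (n' - n - m * (k' - k)) (k' - k) := by
  rw [← dist_mul_left (mk m n k)⁻¹, inv_mul_cancel, len, mk_inv, mk_mul]
  congr 3 <;> ring

theorem len_mul_le (m n k m' n' k' : ℤ) :
    len (m + m') (n + n' + m * k') (k + k') ≤ len m n k + len m' n' k' := by
  have h : cayleyGraph.dist 1 (mk m n k * mk m' n' k') ≤ cayleyGraph.dist 1 (mk m n k) +
      cayleyGraph.dist (mk m n k * 1) (mk m n k * mk m' n' k') := by
    rw [mul_one]; exact cayleyGraph_connected.dist_triangle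
  rw [dist_mul_left, mk_mul] at h
  unfold len
  exact_mod_cast h

theorem len_sign (α β : ℤˣ) (m n k : ℤ) : len (α * m) (α * β * n) (β * k) = len m n k := by
  have h := dist_iso cayleyGraph_connected (cayleyIso α β 1) 1 (mk m n k)
  simp only [cayleyIso_apply, map_one, one_mul, signEquiv_mk] at h
  rw [len, h, len]

theorem len_zero : len 0 0 0 = 0 := by simp [len, ← one_eq]

theorem len_of_mem_generators {m n k : ℤ} (h : mk m n k ∈ generators) : len m n k = 1 := by
  have h1 : cayleyGraph.dist 1 (mk m n k) = 1 :=
    SimpleGraph.dist_eq_one_iff_adj.2 (adj_iff.2 (by simpa using h))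
  rw [len, h1, Nat.cast_one]

theorem len_a_pow_le (m : ℤ) : len m 0 0 ≤ |m| := by
  have h : ∀ m : ℕ, len m 0 0 ≤ m := by
    intro m
    induction m with
    | zero => simp [len_zero]
    | succ m ih =>
      have h1 := len_mul_le m 0 0 1 0 0
      have h2 : len 1 0 0 = 1 := len_of_mem_generators (by simp [mem_generators_mk])
      simp only [mul_zero, add_zero] at h1
      push_cast
      lia
  obtain ⟨j, rfl | rfl⟩ := m.eq_nat_or_neg
  · simpa using h j
  · simpa using (len_sign (-1) 1 j 0 0).trans_le (h j)

theorem len_b_pow_le (k : ℤ) : len 0 0 k ≤ |k| := by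
  have h : ∀ k : ℕ, len 0 0 k ≤ k := by
    intro k
    induction k with
    | zero => simp [len_zero]
    | succ k ih =>
      have h1 := len_mul_le 0 0 k 0 0 1
      have h2 : len 0 0 1 = 1 := len_of_mem_generators (by simp [mem_generators_mk])
      simp only [mul_one, add_zero] at h1
      push_cast
      lia
  obtain ⟨j, rfl | rfl⟩ := k.eq_nat_or_neg
  · simpa using h j
  · simpa using (len_sign 1 (-1) 0 0 j).trans_le (h j)

/-- The element is spelled by b^k a^m b^l. -/
theorem len_le (m k l : ℤ) : len m (m * l) (k + l) ≤ |k| + |m| + |l| := by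
  have h1 := len_mul_le 0 0 k m 0 0
  have h2 := len_mul_le m 0 k 0 0 l
  simp only [zero_add, mul_zero, add_zero] at h1 h2
  linarith [len_a_pow_le m, len_b_pow_le k, len_b_pow_le l]

/-- The isoperimetric estimate: `M` and `μ` bound the first coordinate along a minimal path above
and below, and `p` and `q` count the steps `b` and `b⁻¹`. -/
theorem exists_bounds (m n k : ℤ) : ∃ M μ p q : ℤ, 0 ≤ M ∧ 0 ≤ μ ∧ 0 ≤ p ∧ 0 ≤ q ∧
    -μ ≤ m ∧ m ≤ M ∧ k = p - q ∧ n ≤ M * p + μ * q ∧ -n ≤ M * q + μ * p ∧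
    p + q + 2 * (M + μ) - |m| ≤ len m n k := by
  -- Walks run from the element to e, so that the induction adds the last letter of a word read from
  -- e. A letter a^{±1} can enlarge M or μ; a letter b^{±1} changes n by the current first
  -- coordinate, up to sign. A walk reaching both M and -μ and ending at m needs at least 2(M + μ) -
  -- |m| horizontal steps.
  have key : ∀ {u v : DiscreteHeisenberg} (w : cayleyGraph.Walk u v), v = 1 →
      ∀ m n k, u = mk m n k → ∃ M μ p q : ℤ, 0 ≤ M ∧ 0 ≤ μ ∧ 0 ≤ p ∧ 0 ≤ q ∧
        -μ ≤ m ∧ m ≤ M ∧ k = p - q ∧ n ≤ M * p + μ * q ∧ -n ≤ M * q + μ * p ∧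
        p + q + 2 * (M + μ) - |m| ≤ w.length := by
    intro u v w
    induction w with
    | nil =>
      rintro rfl m n k h
      rw [one_eq, mk_inj] at h
      obtain ⟨rfl, rfl, rfl⟩ := h
      exact ⟨0, 0, 0, 0, by simp⟩
    | @cons u x v hux w ih =>
      rintro rfl m n k rfl
      obtain ⟨m', n', k', rfl⟩ := exists_eq_mk x
      obtain ⟨M, μ, p, q, h1, h2, h3, h4, h5, h6, h7, h8, h9, h10⟩ := ih rfl m' n' k' rfl
      rw [SimpleGraph.Walk.length_cons]
      push_cast
      obtain ⟨s, e | e⟩ := exists_of_adj hux.symm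
      · simp only [mk_mul, mk_inj, mul_zero, add_zero] at e
        obtain ⟨rfl, rfl, rfl⟩ := e
        refine ⟨max M (m' + s), max μ (-(m' + s)), p, q, le_max_of_le_left h1,
          le_max_of_le_left h2, h3, h4, by linarith [le_max_right μ (-(m' + s))],
          le_max_right _ _, h7, ?_, ?_, ?_⟩
        · exact h8.trans (by gcongr <;> exact le_max_left _ _)
        · exact h9.trans (by gcongr <;> exact le_max_left _ _)
        · rcases Int.units_eq_one_or s with rfl | rfl <;> push_cast <;> grind
      · simp only [mk_mul, mk_inj, add_zero] at e
        obtain ⟨rfl, rfl, rfl⟩ := e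
        rcases Int.units_eq_one_or s with rfl | rfl <;> push_cast
        · exact ⟨M, μ, p + 1, q, h1, h2, by lia, h4, h5, h6, by lia, by linarith, by linarith,
            by linarith⟩
        · exact ⟨M, μ, p, q + 1, h1, h2, h3, by lia, h5, h6, by lia, by linarith, by linarith,
            by linarith⟩
  obtain ⟨w, hw⟩ := cayleyGraph_connected.exists_walk_length_eq_dist (mk m n k) 1
  have h := key w rfl m n k rfl
  rwa [hw, SimpleGraph.dist_comm] at h

theorem abs_add_abs_le_len (m n k : ℤ) : |m| + |k| ≤ len m n k := by
  obtain ⟨M, μ, p, q, h1, h2, h3, h4, h5, h6, h7, h8, h9, h10⟩ := exists_bounds m n k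
  grind

/-- An element whose word length is less than two above the length of its abelianization is
represented by a monotone word. -/
theorem between_of_len_lt {m n k : ℤ} (h : len m n k < |m| + |k| + 2) :
    min 0 (m * k) ≤ n ∧ n ≤ max 0 (m * k) := by
  obtain ⟨M, μ, p, q, h1, h2, h3, h4, h5, h6, h7, h8, h9, h10⟩ := exists_bounds m n k
  rcases le_total 0 m with hm | hm <;> rcases le_total 0 k with hk | hk
  -- The excess of the lower bound over |m| + |k| is 2 min(p,q) + 2(M + μ - |m|), which is even;
  -- being less than 2 it vanishes. The other sign cases are alike.
  · obtain rfl : q = 0 := by grind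
    obtain rfl : μ = 0 := by grind
    obtain rfl : M = m := by grind
    obtain rfl : k = p := by grind
    rw [min_eq_left (by positivity), max_eq_right (by positivity)]
    constructor <;> linarith
  · obtain rfl : p = 0 := by grind
    obtain rfl : μ = 0 := by grind
    obtain rfl : M = m := by grind
    obtain rfl : k = -q := by grind
    rw [min_eq_right (by nlinarith), max_eq_left (by nlinarith)]
    constructor <;> linarith
  · obtain rfl : q = 0 := by grind
    obtain rfl : M = 0 := by grind
    obtain rfl : m = -μ := by grind
    obtain rfl : k = p := by grind
    rw [min_eq_right (by nlinarith), max_eq_left (by nlinarith)]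
    constructor <;> linarith
  · obtain rfl : p = 0 := by grind
    obtain rfl : M = 0 := by grind
    obtain rfl : m = -μ := by grind
    obtain rfl : k = -q := by grind
    rw [min_eq_left (by nlinarith), max_eq_right (by nlinarith)]
    constructor <;> linarith

/-- Here p = q, so k² ≤ (M + μ)q, while the length is at least 2(M + μ + q); conclude by AM-GM. -/
theorem four_mul_le_len_sq {k : ℤ} : 4 * k ≤ len 0 (k ^ 2) 0 := by
  obtain ⟨M, μ, p, q, h1, h2, h3, h4, h5, h6, h7, h8, h9, h10⟩ := exists_bounds 0 (k ^ 2) 0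
  obtain rfl : q = p := by lia
  rw [abs_zero] at h10
  by_contra! hlt
  have h11 : M + μ + q < 2 * k := by linarith
  have h12 : (M + μ + q) ^ 2 < (2 * k) ^ 2 := by gcongr
  nlinarith [sq_nonneg (M + μ - q)]

/-- Now q = p + 1 and k² ≤ (M + μ)(p + 1) - M. Since M ≥ 1 the AM-GM comparison is strict, which
recovers the step lost to the shorter vertical part. -/
theorem le_len_one_sq_neg_one {k : ℤ} : 4 * k - 1 ≤ len 1 (k ^ 2) (-1) := by
  obtain ⟨M, μ, p, q, h1, h2, h3, h4, h5, h6, h7, h8, h9, h10⟩ := exists_bounds 1 (k ^ 2) (-1)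
  obtain rfl : q = p + 1 := by lia
  rw [abs_one] at h10
  by_contra! hlt
  have h11 : M + μ + (p + 1) ≤ 2 * k := by lia
  have h12 : (M + μ + (p + 1)) ^ 2 ≤ (2 * k) ^ 2 := by gcongr
  nlinarith [sq_nonneg (M + μ - (p + 1))]

theorem le_len_neg_one_sq_one {k : ℤ} : 4 * k - 1 ≤ len (-1) (k ^ 2) 1 := by
  simpa using le_len_one_sq_neg_one.trans_eq (len_sign (-1) (-1) 1 (k ^ 2) (-1)).symm

/-- Spelled by b^{k-1} a^{-k} b^{-k} a^k, the word for [0,k²,0] with its first letter removed. -/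
theorem len_zero_sq_neg_one_le {k : ℤ} (hk : 1 ≤ k) : len 0 (k ^ 2) (-1) ≤ 4 * k - 1 := by
  have h1 := len_mul_le (-k) 0 (k - 1) k 0 (-k)
  have h2 := len_le (-k) (k - 1) 0
  have h3 := len_le k (-k) 0
  rw [mul_zero, add_zero] at h2 h3
  rw [abs_of_nonneg (by lia : 0 ≤ k - 1), abs_neg, abs_of_nonneg (by lia : 0 ≤ k), abs_zero] at h2
  rw [abs_neg, abs_of_nonneg (by lia : 0 ≤ k), abs_zero] at h3
  have e : len (-k + k) (0 + 0 + -k * -k) (k - 1 + -k) = len 0 (k ^ 2) (-1) := by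
    congr 1 <;> ring
  lia

theorem len_zero_sq_one_le {k : ℤ} (hk : 1 ≤ k) : len 0 (k ^ 2) 1 ≤ 4 * k - 1 := by
  simpa using (len_sign (-1) (-1) 0 (k ^ 2) (-1)).trans_le (len_zero_sq_neg_one_le hk)

/-- Reduction of `NoCommonPredecessor` to the word length. -/
theorem noCommonPredecessor_mk {m n k m₁ n₁ k₁ m₂ n₂ k₂ d₁ d₂ : ℤ}
    (h₁ : len (m - m₁) (n - n₁ - m₁ * (k - k₁)) (k - k₁) ≤ d₁)
    (h₂ : len (m - m₂) (n - n₂ - m₂ * (k - k₂)) (k - k₂) ≤ d₂)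
    (ha : d₁ ≤ len (m + 1 - m₁) (n - n₁ - m₁ * (k - k₁)) (k - k₁) ∨
      d₂ ≤ len (m + 1 - m₂) (n - n₂ - m₂ * (k - k₂)) (k - k₂))
    (ha' : d₁ ≤ len (m + -1 - m₁) (n - n₁ - m₁ * (k - k₁)) (k - k₁) ∨
      d₂ ≤ len (m + -1 - m₂) (n - n₂ - m₂ * (k - k₂)) (k - k₂))
    (hb : d₁ ≤ len (m - m₁) (n + m * 1 - n₁ - m₁ * (k + 1 - k₁)) (k + 1 - k₁) ∨
      d₂ ≤ len (m - m₂) (n + m * 1 - n₂ - m₂ * (k + 1 - k₂)) (k + 1 - k₂))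
    (hb' : d₁ ≤ len (m - m₁) (n + m * -1 - n₁ - m₁ * (k + -1 - k₁)) (k + -1 - k₁) ∨
      d₂ ≤ len (m - m₂) (n + m * -1 - n₂ - m₂ * (k + -1 - k₂)) (k + -1 - k₂)) :
    NoCommonPredecessor cayleyGraph (mk m₁ n₁ k₁) (mk m₂ n₂ k₂) (mk m n k) := by
  rintro p hp ⟨e₁, e₂⟩
  zify at e₁ e₂
  obtain ⟨s, rfl | rfl⟩ := exists_of_adj hp.symm
  · rw [mk_mul, mul_zero, add_zero, add_zero, dist_mk, dist_mk, add_zero] at e₁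
    rw [mk_mul, mul_zero, add_zero, add_zero, dist_mk, dist_mk, add_zero] at e₂
    rcases Int.units_eq_one_or s with rfl | rfl <;> push_cast at e₁ e₂
    · rcases ha with h | h <;> lia
    · rcases ha' with h | h <;> lia
  · rw [mk_mul, add_zero, add_zero, dist_mk, dist_mk] at e₁ e₂
    rcases Int.units_eq_one_or s with rfl | rfl <;> push_cast at e₁ e₂
    · rcases hb with h | h <;> lia
    · rcases hb' with h | h <;> lia

/-! ### Common predecessors in the four families, and rigidity -/

theorem le_len_of_not_between {m n k d : ℤ} (hd : d ≤ |m| + |k| + 2)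
    (h : n < min 0 (m * k) ∨ max 0 (m * k) < n) : d ≤ len m n k := by
  by_contra! hlt
  have := between_of_len_lt (hlt.trans_le hd)
  rcases h with h | h
  · exact h.not_ge this.1
  · exact h.not_ge this.2

theorem le_len_of_le_abs {m n k d : ℤ} (hd : d ≤ |m| + |k|) : d ≤ len m n k :=
  hd.trans (abs_add_abs_le_len m n k)

/-- Only b can be the last letter of a minimal path from e, and b is not the last letter of one from
x = [0,1,2]. -/
theorem noCommonPredecessor_first {j : ℤ} (hj : 1 ≤ j) :
    NoCommonPredecessor cayleyGraph (mk 0 0 0) (mk 0 1 2) (mk 1 1 j) := by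
  have h₁ := len_le 1 (j - 1) 1
  have h₂ := len_le 1 (j - 2) 0
  refine noCommonPredecessor_mk (d₁ := j + 1) (d₂ := |j - 2| + 1) ?_ ?_ ?_ ?_ ?_ ?_
  · simp at h₁ ⊢; simp only [abs_eq_max_neg] at *; omega
  · simp at h₂ ⊢; simp only [abs_eq_max_neg] at *; omega
  · exact Or.inl (le_len_of_le_abs (by simp only [abs_eq_max_neg]; omega))
  · exact Or.inl (le_len_of_not_between (by simp only [abs_eq_max_neg]; omega) (by omega))
  · exact Or.inl (le_len_of_le_abs (by simp only [abs_eq_max_neg]; omega))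
  · refine Or.inr ?_
    rcases lt_or_ge 2 j with hj' | hj'
    · refine le_len_of_not_between (by simp only [abs_eq_max_neg]; omega) (by omega)
    · exact le_len_of_le_abs (by simp only [abs_eq_max_neg]; omega)

theorem noCommonPredecessor_second {j : ℤ} (hj : 1 ≤ j) :
    NoCommonPredecessor cayleyGraph (mk 0 0 0) (mk 0 (-1) 2) (mk (-1) (-1) (j + 2)) := by
  have h₁ := len_le (-1) (j + 1) 1
  have h₂ := len_le (-1) j 0
  refine noCommonPredecessor_mk (d₁ := j + 3) (d₂ := j + 1) ?_ ?_ ?_ ?_ ?_ ?_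
  · rw [show j + 1 + 1 = j + 2 by ring] at h₁
    simp at h₁ ⊢; simp only [abs_eq_max_neg] at *; omega
  · simp at h₂ ⊢; simp only [abs_eq_max_neg] at *; omega
  · exact Or.inl (le_len_of_not_between (by simp only [abs_eq_max_neg]; omega) (by omega))
  · exact Or.inl (le_len_of_le_abs (by simp only [abs_eq_max_neg]; omega))
  · exact Or.inl (le_len_of_le_abs (by simp only [abs_eq_max_neg]; omega))
  · exact Or.inr (le_len_of_not_between (by simp only [abs_eq_max_neg]; omega) (by omega))

theorem noCommonPredecessor_third {j : ℤ} (hj : 1 ≤ j) :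
    NoCommonPredecessor cayleyGraph (mk 0 0 0) (mk 0 1 2) (mk (-1) 0 (j + 1)) := by
  have h₁ := len_le (-1) (j + 1) 0
  have h₂ := len_le (-1) (j - 2) 1
  refine noCommonPredecessor_mk (d₁ := j + 2) (d₂ := |j - 2| + 2) ?_ ?_ ?_ ?_ ?_ ?_
  · simp at h₁ ⊢; simp only [abs_eq_max_neg] at *; omega
  · rw [show j - 2 + 1 = j + 1 - 2 by ring] at h₂
    simp at h₂ ⊢; simp only [abs_eq_max_neg] at *; omega
  · refine Or.inr ?_
    rcases hj.lt_or_eq with hj | rfl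
    · exact le_len_of_not_between (by simp only [abs_eq_max_neg]; omega) (by omega)
    -- For j = 1 the neighbour differs from x by the central element [0,-1,0]; the monotone-word
    -- bound gives only 2, whereas its true length is at least 4.
    · have h := len_sign 1 (-1) 0 1 0
      have h' := four_mul_le_len_sq (k := 1)
      norm_num at h h' ⊢
      lia
  · exact Or.inl (le_len_of_le_abs (by simp only [abs_eq_max_neg]; omega))
  · exact Or.inl (le_len_of_le_abs (by simp only [abs_eq_max_neg]; omega))
  · exact Or.inl (le_len_of_not_between (by simp only [abs_eq_max_neg]; omega) (by omega))

/-- The steps a and b from [0,k²,0] do not approach b, and the steps a⁻¹ and b⁻¹ do not approach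
b⁻¹. -/
theorem noCommonPredecessor_square {k : ℤ} (hk : 1 ≤ k) :
    NoCommonPredecessor cayleyGraph (mk 0 0 1) (mk 0 0 (-1)) (mk 0 (k ^ 2) 0) := by
  refine noCommonPredecessor_mk (d₁ := 4 * k - 1) (d₂ := 4 * k - 1) ?_ ?_ ?_ ?_ ?_ ?_
  · simpa using len_zero_sq_neg_one_le hk
  · simpa using len_zero_sq_one_le hk
  · exact Or.inl (by simpa using le_len_one_sq_neg_one)
  · exact Or.inr (by simpa using le_len_neg_one_sq_one)
  · exact Or.inl (by simpa using (sub_le_self _ zero_le_one).trans four_mul_le_len_sq)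
  · exact Or.inr (by simpa using (sub_le_self _ zero_le_one).trans four_mul_le_len_sq)

/-- A point between b and b⁻¹ is b, e or b⁻¹. Seen from either of b^{±1}, e is too far from
[0,k²,0], and the opposite point is at the same distance from it by the symmetry inverting both
generators. The third vertex is the absence of common predecessors. -/
theorem isRigidTriple_square {k : ℤ} (hk : 1 ≤ k) :
    IsRigidTriple cayleyGraph (mk 0 0 1) (mk 0 0 (-1)) (mk 0 (k ^ 2) 0) := by
  have key : ∀ s : ℤˣ, MinimalPathsMeetOnlyAt cayleyGraph (mk 0 0 s) (mk 0 0 (-s))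
      (mk 0 (k ^ 2) 0) := by
    refine fun s => (minimalPathsMeetOnlyAt_iff cayleyGraph_connected).2 fun w h1 h2 => ?_
    obtain ⟨m, n, l, rfl⟩ := exists_eq_mk w
    zify at h1 h2
    simp only [dist_mk, sub_zero, zero_mul, zero_sub, mul_neg] at h1 h2
    have hs : (s : ℤ) = 1 ∨ (s : ℤ) = -1 := by
      rcases Int.units_eq_one_or s with rfl | rfl <;> simp
    have h3 := abs_add_abs_le_len m n (l - s)
    have h4 := abs_add_abs_le_len (-m) (-n - m * (-s - l)) (-s - l)
    have h5 : len 0 0 (-s - s) ≤ 2 := (len_b_pow_le _).trans (by simp only [abs_eq_max_neg]; omega)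
    have h6 : len 0 (k ^ 2) (-s) ≤ 4 * k - 1 := by
      rcases hs with hs | hs <;> rw [hs]
      · exact len_zero_sq_neg_one_le hk
      · exact len_zero_sq_one_le hk
    simp only [abs_eq_max_neg] at h3 h4
    obtain rfl : m = 0 := by omega
    have h7 := between_of_len_lt (m := 0) (n := n) (k := l - s)
      (by simp only [abs_eq_max_neg]; omega)
    obtain rfl : n = 0 := by omega
    obtain rfl | rfl | hl : l = s ∨ l = 0 ∨ l = -s := by omega
    · rfl
    · have := four_mul_le_len_sq (k := k)
      simp only [zero_sub, sub_zero, neg_zero, mul_zero] at h1 h2 h3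
      omega
    · exfalso
      have h8 := len_sign (-1) (-1) 0 (k ^ 2) (-s)
      rw [hl] at h2 h3
      simp at h8 h2
      omega
  have h := noCommonPredecessor_square hk
  have hk2 : k ^ 2 ≠ 0 := by positivity
  refine ⟨?_, ?_, ?_, ?_, ?_, h.minimalPathsMeetOnlyAt cayleyGraph_connected⟩
  · simp [mk_inj]
  · simp [mk_inj]
  · simp [mk_inj]
  · exact key 1
  · exact key (-1)

/-! ### The word metric, and the relevant words in coordinates -/

theorem dist_eq_cayleyGraph_dist (g h : DiscreteHeisenberg) :
    dist g h = (cayleyGraph.dist g h : ℝ) := rfl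

theorem hasIntegerDist : HasIntegerDist DiscreteHeisenberg := fun g h =>
  ⟨cayleyGraph.dist g h, by rw [dist_eq_cayleyGraph_dist]; norm_cast⟩

instance : DiscreteTopology DiscreteHeisenberg := by
  refine DiscreteTopology.of_forall_le_dist one_pos fun g h hne => ?_
  change (1 : ℝ) ≤ (cayleyGraph.dist g h : ℝ)
  exact_mod_cast cayleyGraph_connected.pos_dist_of_ne hne

theorem a_zpow (m : ℤ) : a ^ m = mk m 0 0 := by
  induction m using Int.induction_on with
  | zero => rw [zpow_zero, one_eq]
  | succ i ih => rw [zpow_add_one, ih, a, mk_mul]; simp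
  | pred i ih => rw [zpow_sub_one, ih, a_inv, mk_mul]; simp [sub_eq_add_neg]

theorem b_zpow (k : ℤ) : b ^ k = mk 0 0 k := by
  induction k using Int.induction_on with
  | zero => rw [zpow_zero, one_eq]
  | succ i ih => rw [zpow_add_one, ih, b, mk_mul]; simp
  | pred i ih => rw [zpow_sub_one, ih, b_inv, mk_mul]; simp [sub_eq_add_neg]

theorem a_mul_b_mul_a_inv_mul_b : a * b * a⁻¹ * b = mk 0 1 2 := by
  rw [a_inv]; simp [a, b, mk_mul]

theorem a_inv_mul_b_mul_a_mul_b : a⁻¹ * b * a * b = mk 0 (-1) 2 := by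
  rw [a_inv]; simp [a, b, mk_mul]

theorem b_zpow_mul_a_mul_b (j : ℤ) : b ^ (j - 1) * a * b = mk 1 1 j := by
  rw [b_zpow]; simp [a, b, mk_mul]

theorem b_pow_mul_a_inv (j : ℕ) : b ^ (j + 1) * a⁻¹ = mk (-1) 0 (j + 1) := by
  rw [← zpow_natCast, b_zpow, a_inv]; simp [mk_mul]

theorem b_pow_mul_a_inv_mul_b (j : ℕ) : b ^ (j + 1) * a⁻¹ * b = mk (-1) (-1) (j + 2) := by
  rw [b_pow_mul_a_inv]; simp [b, mk_mul, add_assoc]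

theorem commutator_pow (k : ℕ) : b ^ k * a⁻¹ ^ k * b⁻¹ ^ k * a ^ k = mk 0 (k ^ 2) 0 := by
  rw [inv_pow, inv_pow, ← zpow_natCast, ← zpow_natCast, ← zpow_neg, ← zpow_neg, a_zpow, a_zpow,
    b_zpow, b_zpow]
  simp [mk_mul, sq]

theorem commutator_pow' (k : ℕ) : b⁻¹ ^ k * a ^ k * b ^ k * a⁻¹ ^ k = mk 0 (k ^ 2) 0 := by
  rw [inv_pow, inv_pow, ← zpow_natCast, ← zpow_natCast, ← zpow_neg, ← zpow_neg, a_zpow, a_zpow,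
    b_zpow, b_zpow]
  simp [mk_mul, sq]

/-! ### Unique minimal paths -/

theorem isUniqueMinimalPath_nil (g : DiscreteHeisenberg) : IsUniqueMinimalPath g g [] := by
  intro p
  rw [IsMinimalPath, SimpleGraph.dist_self, SimpleGraph.Walk.length_eq_zero_iff,
    SimpleGraph.Walk.nil_iff_support_eq]
  rfl

/-- The path is forced as long as exactly one neighbour of the current vertex is nearer to the
target. -/
theorem isUniqueMinimalPath_cons {g h s : DiscreteHeisenberg} {w : List DiscreteHeisenberg}
    (hd : cayleyGraph.dist g h = cayleyGraph.dist (g * s) h + 1)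
    (hs : ∀ p, cayleyGraph.Adj g p → p = g * s ∨ cayleyGraph.dist g h ≤ cayleyGraph.dist p h)
    (hw : IsUniqueMinimalPath (g * s) h w) : IsUniqueMinimalPath g h (s :: w) := by
  intro p
  cases p with
  | nil => rw [SimpleGraph.dist_self] at hd; lia
  | @cons _ x _ hx p =>
    have htrace : trace g (s :: w) = g :: trace (g * s) w := by simp [trace]
    rw [htrace, SimpleGraph.Walk.support_cons, List.cons.injEq]
    constructor
    · intro hp
      rw [IsMinimalPath, SimpleGraph.Walk.length_cons] at hp
      have h1 := SimpleGraph.dist_le p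
      rcases hs x hx with rfl | h2
      · exact ⟨rfl, (hw p).1 (by rw [IsMinimalPath]; lia)⟩
      · lia
    · rintro ⟨-, hp⟩
      have hxs : x = g * s := by
        have h1 := congrArg List.head? hp
        have h2 : (trace (g * s) w).head? = some (g * s) := by cases w <;> simp [trace]
        rw [h2, ← SimpleGraph.Walk.cons_tail_support, List.head?_cons] at h1
        exact Option.some.inj h1
      subst hxs
      have h1 := (hw p).2 hp
      rw [IsMinimalPath] at h1 ⊢
      rw [SimpleGraph.Walk.length_cons, h1, hd]

theorem isUniqueMinimalPath_cons_a {m n k m' n' k' d : ℤ} {w : List DiscreteHeisenberg}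
    (h : len (m' - m) (n' - n - m * (k' - k)) (k' - k) = d + 1)
    (h₁ : len (m' - (m + 1)) (n' - n - (m + 1) * (k' - k)) (k' - k) = d)
    (h₂ : d + 1 ≤ len (m' - (m + -1)) (n' - n - (m + -1) * (k' - k)) (k' - k))
    (h₃ : d + 1 ≤ len (m' - m) (n' - (n + m) - m * (k' - (k + 1))) (k' - (k + 1)))
    (h₄ : d + 1 ≤ len (m' - m) (n' - (n + -m) - m * (k' - (k + -1))) (k' - (k + -1)))
    (hw : IsUniqueMinimalPath (mk (m + 1) n k) (mk m' n' k') w) :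
    IsUniqueMinimalPath (mk m n k) (mk m' n' k') (a :: w) := by
  have ha : mk m n k * a = mk (m + 1) n k := by simp [a, mk_mul]
  refine isUniqueMinimalPath_cons ?_ ?_ (ha ▸ hw)
  · rw [ha]; zify; rw [dist_mk, dist_mk, h, h₁]
  · intro p hp
    obtain ⟨s, rfl | rfl⟩ := exists_of_adj hp <;> rcases Int.units_eq_one_or s with rfl | rfl
    · exact Or.inl rfl
    · right; zify; simpa [mk_mul, dist_mk, h] using h₂
    · right; zify; simpa [mk_mul, dist_mk, h] using h₃
    · right; zify; simpa [mk_mul, dist_mk, h] using h₄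

theorem isUniqueMinimalPath_cons_b {m n k m' n' k' d : ℤ} {w : List DiscreteHeisenberg}
    (h : len (m' - m) (n' - n - m * (k' - k)) (k' - k) = d + 1)
    (h₁ : len (m' - m) (n' - (n + m) - m * (k' - (k + 1))) (k' - (k + 1)) = d)
    (h₂ : d + 1 ≤ len (m' - (m + 1)) (n' - n - (m + 1) * (k' - k)) (k' - k))
    (h₃ : d + 1 ≤ len (m' - (m + -1)) (n' - n - (m + -1) * (k' - k)) (k' - k))
    (h₄ : d + 1 ≤ len (m' - m) (n' - (n + -m) - m * (k' - (k + -1))) (k' - (k + -1)))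
    (hw : IsUniqueMinimalPath (mk m (n + m) (k + 1)) (mk m' n' k') w) :
    IsUniqueMinimalPath (mk m n k) (mk m' n' k') (b :: w) := by
  have hb : mk m n k * b = mk m (n + m) (k + 1) := by simp [b, mk_mul]
  refine isUniqueMinimalPath_cons ?_ ?_ (hb ▸ hw)
  · rw [hb]; zify; rw [dist_mk, dist_mk, h, h₁]
  · intro p hp
    obtain ⟨s, rfl | rfl⟩ := exists_of_adj hp <;> rcases Int.units_eq_one_or s with rfl | rfl
    · right; zify; simpa [mk_mul, dist_mk, h] using h₂
    · right; zify; simpa [mk_mul, dist_mk, h] using h₃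
    · exact Or.inl rfl
    · right; zify; simpa [mk_mul, dist_mk, h] using h₄

/-- The monotone word b^{k-l} a^m b^l attains the lower bound coming from the abelianization. -/
theorem len_eq {m n k : ℤ} (l : ℤ) (hn : n = m * l) (hl : 0 ≤ l) (hk : l ≤ k) :
    len m n k = |m| + k := by
  refine le_antisymm ?_ ?_
  · have h := len_le m (k - l) l
    rw [sub_add_cancel, ← hn, abs_of_nonneg (sub_nonneg.2 hk), abs_of_nonneg hl] at h
    linarith
  · exact (abs_add_abs_le_len m n k).trans' (by rw [abs_of_nonneg (hl.trans hk)])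

theorem isUniqueMinimalPath_pow_a_b (i : ℕ) (l : ℤ) :
    IsUniqueMinimalPath (mk 0 0 l) (mk 1 1 (l + i + 1)) (List.replicate i b ++ [a, b]) := by
  -- The start b^l moves up while the target, which depends only on l + i, stays fixed.
  induction i generalizing l with
  | zero =>
    rw [List.replicate_zero, List.nil_append, Nat.cast_zero, add_zero]
    refine isUniqueMinimalPath_cons_a (d := 1) ?_ ?_ ?_ ?_ ?_ ?_
    · rw [len_eq 1] <;> norm_num
    · rw [len_eq 0] <;> norm_num
    · exact le_len_of_le_abs (by simp only [abs_eq_max_neg]; omega)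
    · exact le_len_of_not_between (by simp only [abs_eq_max_neg]; omega) (by omega)
    · exact le_len_of_le_abs (by simp only [abs_eq_max_neg]; omega)
    refine isUniqueMinimalPath_cons_b (d := 0) ?_ ?_ ?_ ?_ ?_ ?_
    · rw [len_eq 0] <;> norm_num
    · rw [len_eq 0] <;> norm_num
    · exact le_len_of_le_abs (by simp only [abs_eq_max_neg]; omega)
    · exact le_len_of_le_abs (by simp only [abs_eq_max_neg]; omega)
    · exact le_len_of_le_abs (by simp only [abs_eq_max_neg]; omega)
    exact isUniqueMinimalPath_nil _
  | succ i ih =>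
    rw [List.replicate_succ, List.cons_append]
    refine isUniqueMinimalPath_cons_b (d := i + 2) ?_ ?_ ?_ ?_ ?_ ?_
    · rw [len_eq 1 (by ring) (by norm_num) (by push_cast; omega)]; push_cast; ring
    · rw [len_eq 1 (by ring) (by norm_num) (by push_cast; omega)]; push_cast; ring
    · exact le_len_of_not_between (by simp only [abs_eq_max_neg]; omega) (by omega)
    · exact le_len_of_le_abs (by simp only [abs_eq_max_neg]; omega)
    · exact le_len_of_le_abs (by simp only [abs_eq_max_neg]; omega)
    · rw [Nat.cast_succ, add_comm (i : ℤ), ← add_assoc]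
      exact ih (l + 1)

theorem isUniqueMinimalPath_pow_a (i : ℕ) (l : ℤ) :
    IsUniqueMinimalPath (mk 0 1 l) (mk 1 1 (l + i)) (List.replicate i b ++ [a]) := by
  induction i generalizing l with
  | zero =>
    rw [List.replicate_zero, List.nil_append, Nat.cast_zero, add_zero]
    refine isUniqueMinimalPath_cons_a (d := 0) ?_ ?_ ?_ ?_ ?_ ?_
    · rw [len_eq 0] <;> norm_num
    · rw [len_eq 0] <;> norm_num
    · exact le_len_of_le_abs (by simp only [abs_eq_max_neg]; omega)
    · exact le_len_of_le_abs (by simp only [abs_eq_max_neg]; omega)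
    · exact le_len_of_le_abs (by simp only [abs_eq_max_neg]; omega)
    exact isUniqueMinimalPath_nil _
  | succ i ih =>
    rw [List.replicate_succ, List.cons_append]
    refine isUniqueMinimalPath_cons_b (d := i + 1) ?_ ?_ ?_ ?_ ?_ ?_
    · rw [len_eq 0 (by ring) (by norm_num) (by push_cast; omega)]; push_cast; ring
    · rw [len_eq 0 (by ring) (by norm_num) (by push_cast; omega)]; push_cast; ring
    · exact le_len_of_not_between (by simp only [abs_eq_max_neg]; omega) (by omega)
    · exact le_len_of_le_abs (by simp only [abs_eq_max_neg]; omega)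
    · exact le_len_of_le_abs (by simp only [abs_eq_max_neg]; omega)
    · rw [Nat.cast_succ, add_comm (i : ℤ), ← add_assoc]
      exact ih (l + 1)

theorem perimeter_first {j : ℤ} (hj : 2 ≤ j) :
    (perimeter cayleyGraph (mk 0 0 0) (mk 0 1 2) (mk 1 1 j) : ℤ) = 4 + 2 * j := by
  have h1 : len 0 1 2 = 4 := by
    refine le_antisymm ?_ (le_len_of_not_between (by norm_num) (by norm_num))
    -- The factorization x = (ab)(a⁻¹b).
    have h := len_mul_le 1 1 1 (-1) (-1) 1
    have h2 := len_le 1 0 1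
    have h3 := len_le (-1) 0 1
    norm_num at h h2 h3
    lia
  rw [perimeter, SimpleGraph.dist_comm (u := mk 1 1 j)]
  push_cast
  simp only [dist_mk, sub_zero, zero_mul, sub_self]
  rw [h1, len_eq 0 (by ring) le_rfl (by lia), len_eq 1 (by ring) (by norm_num) (by lia), abs_one]
  ring

/-! ### Non-Busemann points -/

theorem tendsto_cofinite_of_injective {c : ℕ → DiscreteHeisenberg} (hc : Function.Injective c) :
    Tendsto c atTop cofinite :=
  Nat.cofinite_eq_atTop ▸ hc.tendsto_cofinite

theorem not_mem_busemannPoints {u v : DiscreteHeisenberg} {c : ℕ → DiscreteHeisenberg}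
    (h : ∀ j, 1 ≤ j → NoCommonPredecessor cayleyGraph u v (c j)) (hc : Function.Injective c)
    {ω : MetricCompactification DiscreteHeisenberg} (hω : ω ∈ limitPoints c) :
    ω ∉ busemannPoints DiscreteHeisenberg := by
  intro hB
  obtain ⟨p, hp⟩ := exists_frequently_of_busemannPoint hasIntegerDist hB hω u v
  have hne : ∀ᶠ j in atTop, c j ≠ p :=
    (tendsto_cofinite_of_injective hc).eventually (Set.finite_singleton p).compl_mem_cofinite
  obtain ⟨j, ⟨h1, h2⟩, hj, hj1⟩ :=
    (hp.and_eventually (hne.and (eventually_ge_atTop 1))).exists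
  simp only [dist_eq_cayleyGraph_dist] at h1 h2
  norm_cast at h1 h2
  refine hj ((h j hj1).eq_of_dist_add cayleyGraph_connected ?_ ?_).symm
  · rw [SimpleGraph.dist_comm, add_comm, SimpleGraph.dist_comm (u := p), ← h1,
      SimpleGraph.dist_comm]
  · rw [SimpleGraph.dist_comm, add_comm, SimpleGraph.dist_comm (u := p), ← h2,
      SimpleGraph.dist_comm]

/-- The automorphism φ carries the translations and sign changes; `hd` serves only to make the
perimeter unbounded. -/
theorem giveNonBusemannPoints_of_noCommonPredecessor {u v : DiscreteHeisenberg}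
    {c : ℕ → DiscreteHeisenberg} (φ : cayleyGraph ≃g cayleyGraph)
    (h : ∀ j, 1 ≤ j → NoCommonPredecessor cayleyGraph u v (c j)) (hc : Function.Injective c)
    (hd : ∀ j : ℕ, (j : ℤ) ≤ cayleyGraph.dist u (c j)) :
    GiveNonBusemannPoints (φ u) (φ v) fun j => φ (c j) := by
  have h' := fun j hj => (h j hj).map cayleyGraph_connected φ
  have hc' : Function.Injective fun j => φ (c j) := φ.injective.comp hc
  refine ⟨fun j hj => (h' j hj).noMinimalPathsShareTail cayleyGraph_connected, ?_,
    limitPoints_nonempty _, fun ω hω => ⟨?_, not_mem_busemannPoints h' hc' hω⟩⟩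
  · refine tendsto_atTop_mono (fun j => ?_) tendsto_id
    rw [perimeter_map cayleyGraph_connected, perimeter, SimpleGraph.dist_comm (u := c j)]
    have := hd j
    dsimp only [id]
    lia
  · exact tendsto_mem_metricBoundary (tendsto_cofinite_of_injective hc') hω

theorem giveNonBusemannPoints_first (φ : cayleyGraph ≃g cayleyGraph) :
    GiveNonBusemannPoints (φ 1) (φ (a * b * a⁻¹ * b))
      (fun j => φ (b ^ ((j : ℤ) - 1) * a * b)) := by
  simp only [one_eq, a_mul_b_mul_a_inv_mul_b, b_zpow_mul_a_mul_b]
  refine giveNonBusemannPoints_of_noCommonPredecessor φ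
    (fun j hj => noCommonPredecessor_first (by lia)) ?_ ?_
  · intro i j h
    simpa [mk_inj] using h
  · intro j
    rw [dist_mk]
    exact le_len_of_le_abs (by simp only [abs_eq_max_neg]; omega)

theorem giveNonBusemannPoints_second (φ : cayleyGraph ≃g cayleyGraph) :
    GiveNonBusemannPoints (φ 1) (φ (a⁻¹ * b * a * b))
      (fun j => φ (b ^ (j + 1) * a⁻¹ * b)) := by
  simp only [one_eq, a_inv_mul_b_mul_a_mul_b, b_pow_mul_a_inv_mul_b]
  refine giveNonBusemannPoints_of_noCommonPredecessor φ
    (fun j hj => noCommonPredecessor_second (by lia)) ?_ ?_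
  · intro i j h
    simpa [mk_inj] using h
  · intro j
    rw [dist_mk]
    exact le_len_of_le_abs (by simp only [abs_eq_max_neg]; omega)

theorem giveNonBusemannPoints_third (φ : cayleyGraph ≃g cayleyGraph) :
    GiveNonBusemannPoints (φ 1) (φ (a * b * a⁻¹ * b)) (fun j => φ (b ^ (j + 1) * a⁻¹)) := by
  simp only [one_eq, a_mul_b_mul_a_inv_mul_b, b_pow_mul_a_inv]
  refine giveNonBusemannPoints_of_noCommonPredecessor φ
    (fun j hj => noCommonPredecessor_third (by lia)) ?_ ?_
  · intro i j h
    simpa [mk_inj] using h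
  · intro j
    rw [dist_mk]
    exact le_len_of_le_abs (by simp only [abs_eq_max_neg]; omega)

theorem giveNonBusemannPoints_square (φ : cayleyGraph ≃g cayleyGraph) :
    GiveNonBusemannPoints (φ b) (φ b⁻¹) (fun k => φ (b ^ k * a⁻¹ ^ k * b⁻¹ ^ k * a ^ k)) := by
  simp only [commutator_pow]
  rw [b_inv, b]
  refine giveNonBusemannPoints_of_noCommonPredecessor φ
    (fun j hj => noCommonPredecessor_square (by lia)) ?_ ?_
  · intro i j h
    simpa [mk_inj] using h
  · intro j
    rw [dist_mk]
    have h1 := len_mul_le 0 (j ^ 2) (-1) 0 0 1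
    have h2 := len_b_pow_le 1
    have h3 := four_mul_le_len_sq (k := j)
    have h4 := abs_add_abs_le_len 0 ((j : ℤ) ^ 2) (-1)
    norm_num at h1 h2 h3 h4 ⊢
    lia

theorem isRigidTriple_map {u v w : DiscreteHeisenberg} (φ : cayleyGraph ≃g cayleyGraph)
    (h : IsRigidTriple cayleyGraph u v w) : IsRigidTriple cayleyGraph (φ u) (φ v) (φ w) := by
  obtain ⟨h1, h2, h3, h4, h5, h6⟩ := h
  exact ⟨φ.injective.ne h1, φ.injective.ne h2, φ.injective.ne h3,
    h4.map cayleyGraph_connected φ, h5.map cayleyGraph_connected φ,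
    h6.map cayleyGraph_connected φ⟩

/-- The function φ_{y,z} vanishes at the accumulation points of c, and, being integer valued, stays
away from 0 along c'. -/
theorem disjoint_limitPoints {c c' : ℕ → DiscreteHeisenberg} {y z : DiscreteHeisenberg}
    (h : ∀ᶠ j in atTop, cayleyGraph.dist y (c j) = cayleyGraph.dist z (c j))
    (h' : ∀ᶠ j in atTop, cayleyGraph.dist y (c' j) ≠ cayleyGraph.dist z (c' j)) :
    Disjoint (limitPoints c) (limitPoints c') := by
  refine Set.disjoint_left.2 fun ω hω hω' => ?_
  have h1 : ∀ᶠ j in atTop, dist (c j) y - dist (c j) z = 0 := h.mono fun j hj => by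
    rw [dist_comm, dist_comm (c j), dist_eq_cayleyGraph_dist, dist_eq_cayleyGraph_dist, hj,
      sub_self]
  obtain ⟨j, hj, hj'⟩ := ((hasIntegerDist.frequently_eq hω' hω h1).and_eventually h').exists
  rw [dist_comm, dist_comm (c' j), dist_eq_cayleyGraph_dist, dist_eq_cayleyGraph_dist,
    sub_eq_zero] at hj
  exact hj' (by exact_mod_cast hj)

theorem disjoint_limitPoints_second :
    Disjoint (limitPoints fun j : ℕ => b ^ (j + 1) * a⁻¹ * b)
      (limitPoints fun j : ℕ => b ^ ((j : ℤ) - 1) * a * b) := by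
  simp only [b_pow_mul_a_inv_mul_b, b_zpow_mul_a_mul_b]
  -- Passing from e to the central element [0,2,0] lowers n by 2. For m = -1 this keeps n in the
  -- monotone range [-k,0] for large k; for c_j, with m = 1 and n = 1, it leaves the range [0,k] and
  -- costs two more steps.
  refine disjoint_limitPoints (y := mk 0 2 0) (z := mk 0 0 0) ?_ ?_
  · filter_upwards [eventually_ge_atTop 1] with j hj
    zify
    rw [dist_mk, dist_mk, len_eq 3 (by ring) (by norm_num) (by lia),
      len_eq 1 (by ring) (by norm_num) (by lia)]
  · filter_upwards [eventually_ge_atTop 1] with j hj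
    zify
    rw [dist_mk, dist_mk, len_eq (n := 1 - 0 - 0 * _) 1 (by ring) (by norm_num) (by lia)]
    refine ne_of_gt (lt_of_lt_of_le (b := (j + 3 : ℤ)) ?_ ?_)
    · rw [sub_zero, sub_zero, abs_one]
      lia
    · exact le_len_of_not_between (by simp only [abs_eq_max_neg]; omega) (by omega)

theorem disjoint_limitPoints_third :
    Disjoint (limitPoints fun j : ℕ => b ^ (j + 1) * a⁻¹)
      (limitPoints fun j : ℕ => b ^ ((j : ℤ) - 1) * a * b) := by
  simp only [b_pow_mul_a_inv, b_zpow_mul_a_mul_b]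
  refine disjoint_limitPoints (y := mk 0 2 0) (z := mk 0 0 0) ?_ ?_
  · filter_upwards [eventually_ge_atTop 1] with j hj
    zify
    rw [dist_mk, dist_mk, len_eq 2 (by ring) (by norm_num) (by lia),
      len_eq 0 (by ring) (by norm_num) (by lia)]
  · filter_upwards [eventually_ge_atTop 1] with j hj
    zify
    rw [dist_mk, dist_mk, len_eq (n := 1 - 0 - 0 * _) 1 (by ring) (by norm_num) (by lia)]
    refine ne_of_gt (lt_of_lt_of_le (b := (j + 3 : ℤ)) ?_ ?_)
    · rw [sub_zero, sub_zero, abs_one]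
      lia
    · exact le_len_of_not_between (by simp only [abs_eq_max_neg]; omega) (by omega)

theorem infinite_limitPoints :
    {ω | ∃ g : DiscreteHeisenberg, ω ∈ limitPoints fun j : ℕ =>
      g * (b ^ ((j : ℤ) - 1) * a * b)}.Infinite := by
  choose f hf using fun N : ℕ =>
    limitPoints_nonempty fun j : ℕ => mk 0 N 0 * (b ^ ((j : ℤ) - 1) * a * b)
  refine Set.infinite_of_injective_forall_mem (f := f) ?_ fun N => ⟨mk 0 N 0, hf N⟩
  have key : ∀ N N' : ℕ, N < N' → f N ≠ f N' := by
    intro N N' hN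
    refine fun h => Set.disjoint_left.1 ?_ (hf N') (h ▸ hf N)
    simp only [b_zpow_mul_a_mul_b, mk_mul]
    -- The translates are by central elements. This y brings n to 0 for N', still monotone, but to N
    -- - N' < 0 for N.
    refine disjoint_limitPoints (y := mk 0 (N' + 1) 0) (z := mk 0 0 0) ?_ ?_
    · filter_upwards [eventually_ge_atTop (N' + 1)] with j hj
      zify
      rw [dist_mk, dist_mk, len_eq 0 (by ring) (by norm_num) (by lia),
        len_eq (N' + 1) (by ring) (by lia) (by lia)]
    · filter_upwards [eventually_ge_atTop (N + 1)] with j hj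
      zify
      rw [dist_mk, dist_mk,
        len_eq (n := (N : ℤ) + 1 + 0 * j - 0 - 0 * _) (N + 1) (by ring) (by lia) (by lia)]
      refine ne_of_gt (lt_of_lt_of_le (b := (j + 3 : ℤ)) ?_ ?_)
      · rw [zero_add, sub_zero, zero_add, sub_zero, abs_one]
        lia
      · exact le_len_of_not_between (by simp only [abs_eq_max_neg]; omega) (by omega)
  intro N N' h
  by_contra hne
  rcases lt_or_gt_of_ne hne with hlt | hlt
  · exact key _ _ hlt h
  · exact key _ _ hlt h.symm

/-! ### Geodesic rays -/

theorem len_a_zpow (m : ℤ) : len m 0 0 = |m| :=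
  le_antisymm (len_a_pow_le m) (by simpa using abs_add_abs_le_len m 0 0)

theorem len_b_zpow (k : ℤ) : len 0 0 k = |k| :=
  le_antisymm (len_b_pow_le k) (by simpa using abs_add_abs_le_len 0 0 k)

theorem cayleyGraph_dist_ray (i) (s t : ℕ) :
    (cayleyGraph.dist (ray i s) (ray i t) : ℤ) = |(s : ℤ) - t| := by
  rcases i with ⟨n, k, ε⟩ | ⟨m, n, ε⟩
  · rw [ray, verticalRay, verticalRay, dist_mk, sub_self, sub_self, mul_zero, sub_zero, len_a_zpow,
      ← mul_sub, abs_mul, Int.isUnit_iff_abs_eq.1 ε.isUnit, one_mul, abs_sub_comm]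
  · rw [ray, horizontalRay, horizontalRay, dist_mk, sub_self]
    rw [show n + ε * (t * m) - (n + ε * (s * m)) - m * (ε * t - ε * s) = 0 by ring, len_b_zpow,
      ← mul_sub, abs_mul, Int.isUnit_iff_abs_eq.1 ε.isUnit, one_mul, abs_sub_comm]

theorem dist_ray (i) (s t : ℕ) : dist (ray i s) (ray i t) = |(s : ℝ) - t| := by
  rw [dist_eq_cayleyGraph_dist]
  exact_mod_cast congrArg (Int.cast (R := ℝ)) (cayleyGraph_dist_ray i s t)

theorem ray_injective (i) : Function.Injective (ray i) := by
  intro s t h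
  have h1 := dist_ray i s t
  rw [h, dist_self, eq_comm, abs_eq_zero, sub_eq_zero] at h1
  exact_mod_cast h1

/-- Distinct rays separate. -/
theorem exists_sub_lt_dist_ray {i j} (hij : i ≠ j) : ∃ S : ℕ, ∀ s t : ℕ, S ≤ s → s ≤ t →
    (t : ℤ) - s < cayleyGraph.dist (ray i t) (ray j s) := by
  rcases i with ⟨n, k, ε⟩ | ⟨m, n, ε⟩ <;> rcases j with ⟨n', k', ε'⟩ | ⟨m', n', ε'⟩
  · refine ⟨1, fun s t hs hst => ?_⟩
    simp only [ray, verticalRay, dist_mk]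
    rw [← Int.add_one_le_iff]
    by_cases hε : ε = ε' ∧ k = k'
    · obtain ⟨rfl, rfl⟩ := hε
      have hn : n ≠ n' := by rintro rfl; exact hij rfl
      rw [sub_self, mul_zero, sub_zero]
      rcases Int.units_eq_one_or ε with rfl | rfl <;>
        refine le_len_of_not_between ?_ (by omega) <;> push_cast <;>
        simp only [abs_eq_max_neg] <;> omega
    · refine le_len_of_le_abs ?_
      rcases Int.units_eq_one_or ε with rfl | rfl <;>
        rcases Int.units_eq_one_or ε' with rfl | rfl <;> simp at hε <;> push_cast <;>
        simp only [abs_eq_max_neg] <;> omega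
  -- In the abelianization the distance is at least t - |m'| + s - |k|, which exceeds t - s once 2s
  -- > |m'| + |k|.
  · refine ⟨m'.natAbs + k.natAbs + 1, fun s t hs hst => ?_⟩
    simp only [ray, verticalRay, horizontalRay, dist_mk]
    rw [← Int.add_one_le_iff]
    refine le_len_of_le_abs ?_
    rcases Int.units_eq_one_or ε with rfl | rfl <;>
      rcases Int.units_eq_one_or ε' with rfl | rfl <;> push_cast <;>
      simp only [abs_eq_max_neg] <;> omega
  · refine ⟨m.natAbs + k'.natAbs + 1, fun s t hs hst => ?_⟩
    simp only [ray, verticalRay, horizontalRay, dist_mk]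
    rw [← Int.add_one_le_iff]
    refine le_len_of_le_abs ?_
    rcases Int.units_eq_one_or ε with rfl | rfl <;>
      rcases Int.units_eq_one_or ε' with rfl | rfl <;> push_cast <;>
      simp only [abs_eq_max_neg] <;> omega
  · refine ⟨1, fun s t hs hst => ?_⟩
    simp only [ray, horizontalRay, dist_mk]
    rw [← Int.add_one_le_iff]
    by_cases hε : ε = ε' ∧ m = m'
    · obtain ⟨rfl, rfl⟩ := hε
      have hn : n ≠ n' := by rintro rfl; exact hij rfl
      rw [show n' + ε * (s * m) - (n + ε * (t * m)) - m * (ε * s - ε * t) = n' - n by ring,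
        sub_self]
      rcases Int.units_eq_one_or ε with rfl | rfl <;>
        refine le_len_of_not_between ?_ (by rw [zero_mul]; omega) <;> push_cast <;>
        simp only [abs_eq_max_neg] <;> omega
    · refine le_len_of_le_abs ?_
      rcases Int.units_eq_one_or ε with rfl | rfl <;>
        rcases Int.units_eq_one_or ε' with rfl | rfl <;> simp at hε <;> push_cast <;>
        simp only [abs_eq_max_neg] <;> omega

/-- For large s, φ_{y,z} with y and z the points of the two rays at time s is negative far out on
the first ray and positive far out on the second, so a common limit is impossible. -/
theorem limit_ray_ne {i j} (hij : i ≠ j) {ω : MetricCompactification DiscreteHeisenberg}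
    (hi : Tendsto (fun t => toCompactification (ray i t)) atTop (𝓝 ω)) :
    ¬ Tendsto (fun t => toCompactification (ray j t)) atTop (𝓝 ω) := by
  intro hj
  obtain ⟨S, hS⟩ := exists_sub_lt_dist_ray hij
  obtain ⟨S', hS'⟩ := exists_sub_lt_dist_ray hij.symm
  set s := max S S'
  have hev := eventually_norm_distDifference_lt ω (ray i s) (ray j s)
  obtain ⟨t, ht, hst⟩ := ((hi.eventually hev).and (eventually_ge_atTop s)).exists
  obtain ⟨t', ht', hst'⟩ := ((hj.eventually hev).and (eventually_ge_atTop s)).exists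
  have h := hasIntegerDist.sub_eq_of_norm_lt ht ht'
  have h1 := hS s t (le_max_left _ _) hst
  have h2 := hS' s t' (le_max_right _ _) hst'
  have h3 := cayleyGraph_dist_ray i t s
  have h4 := cayleyGraph_dist_ray j t' s
  simp only [dist_eq_cayleyGraph_dist] at h
  rw [sub_eq_sub_iff_add_eq_add] at h
  norm_cast at h
  rw [abs_of_nonneg (by lia)] at h3 h4
  lia

theorem exists_cayleyIso {A B : DiscreteHeisenberg} (hA : A = a ∨ A = a⁻¹) (hB : B = b ∨ B = b⁻¹) :
    ∃ θ : DiscreteHeisenberg ≃* DiscreteHeisenberg, θ a = A ∧ θ b = B ∧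
      ∀ g, ∃ φ : cayleyGraph ≃g cayleyGraph, ∀ x, φ x = g * θ x := by
  have h : ∃ α : ℤˣ, mk α 0 0 = A := by
    rcases hA with rfl | rfl
    · exact ⟨1, rfl⟩
    · exact ⟨-1, a_inv.symm⟩
  have h' : ∃ β : ℤˣ, mk 0 0 β = B := by
    rcases hB with rfl | rfl
    · exact ⟨1, rfl⟩
    · exact ⟨-1, b_inv.symm⟩
  obtain ⟨α, rfl⟩ := h
  obtain ⟨β, rfl⟩ := h'
  exact ⟨signEquiv α β, by simp [a, signEquiv_mk], by simp [b, signEquiv_mk], fun g =>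
    ⟨cayleyIso α β g, fun x => rfl⟩⟩

end DiscreteHeisenberg

end

/-! ### The example: all families, their symmetries and the rays -/

theorem mainTheorem10 :
    -- `S = {a, b, a⁻¹, b⁻¹}` generates the group
    Subgroup.closure DiscreteHeisenberg.generators = ⊤ ∧
    -- the triples `{e, x = a b a⁻¹ b, c_j = b ^ (j - 1) a b}`
    (∀ j : ℕ, 1 ≤ j →
      DiscreteHeisenberg.IsUniqueMinimalPath 1
        (DiscreteHeisenberg.b ^ ((j : ℤ) - 1) * DiscreteHeisenberg.a * DiscreteHeisenberg.b)
        (List.replicate (j - 1) DiscreteHeisenberg.b ++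
          [DiscreteHeisenberg.a, DiscreteHeisenberg.b])) ∧
    (∀ j : ℕ, 2 ≤ j →
      DiscreteHeisenberg.IsUniqueMinimalPath
        (DiscreteHeisenberg.a * DiscreteHeisenberg.b * DiscreteHeisenberg.a⁻¹ *
          DiscreteHeisenberg.b)
        (DiscreteHeisenberg.b ^ ((j : ℤ) - 1) * DiscreteHeisenberg.a * DiscreteHeisenberg.b)
        (List.replicate (j - 2) DiscreteHeisenberg.b ++ [DiscreteHeisenberg.a]) ∧
      perimeter DiscreteHeisenberg.cayleyGraph 1
        (DiscreteHeisenberg.a * DiscreteHeisenberg.b * DiscreteHeisenberg.a⁻¹ *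
          DiscreteHeisenberg.b)
        (DiscreteHeisenberg.b ^ ((j : ℤ) - 1) * DiscreteHeisenberg.a * DiscreteHeisenberg.b)
        = 4 + 2 * j) ∧
    -- the families of triples that give non-Busemann points, together with their left translates
    -- and with the families obtained by inverting generators
    (∀ (A B g : DiscreteHeisenberg),
      (A = DiscreteHeisenberg.a ∨ A = DiscreteHeisenberg.a⁻¹) →
      (B = DiscreteHeisenberg.b ∨ B = DiscreteHeisenberg.b⁻¹) →
      DiscreteHeisenberg.GiveNonBusemannPoints (g * 1) (g * (A * B * A⁻¹ * B))
        (fun j => g * (B ^ ((j : ℤ) - 1) * A * B)) ∧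
      DiscreteHeisenberg.GiveNonBusemannPoints (g * 1) (g * (A⁻¹ * B * A * B))
        (fun j => g * (B ^ (j + 1) * A⁻¹ * B)) ∧
      DiscreteHeisenberg.GiveNonBusemannPoints (g * 1) (g * (A * B * A⁻¹ * B))
        (fun j => g * (B ^ (j + 1) * A⁻¹)) ∧
      DiscreteHeisenberg.GiveNonBusemannPoints (g * B) (g * B⁻¹)
        (fun k => g * (B ^ k * A⁻¹ ^ k * B⁻¹ ^ k * A ^ k)) ∧
      (∀ k : ℕ, B ^ k * A⁻¹ ^ k * B⁻¹ ^ k * A ^ k = B⁻¹ ^ k * A ^ k * B ^ k * A⁻¹ ^ k) ∧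
      (∀ k : ℕ, 1 ≤ k →
        IsRigidTriple DiscreteHeisenberg.cayleyGraph (g * B) (g * B⁻¹)
          (g * (B ^ k * A⁻¹ ^ k * B⁻¹ ^ k * A ^ k)))) ∧
    -- the second kind of triples gives other points than the first
    Disjoint
      (limitPoints (fun j : ℕ => DiscreteHeisenberg.b ^ (j + 1) * DiscreteHeisenberg.a⁻¹ *
        DiscreteHeisenberg.b))
      (limitPoints (fun j : ℕ => DiscreteHeisenberg.b ^ ((j : ℤ) - 1) * DiscreteHeisenberg.a *
        DiscreteHeisenberg.b)) ∧
    Disjoint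
      (limitPoints (fun j : ℕ => DiscreteHeisenberg.b ^ (j + 1) * DiscreteHeisenberg.a⁻¹))
      (limitPoints (fun j : ℕ => DiscreteHeisenberg.b ^ ((j : ℤ) - 1) * DiscreteHeisenberg.a *
        DiscreteHeisenberg.b)) ∧
    -- left translation gives infinitely many non-Busemann points
    {ω | ∃ g : DiscreteHeisenberg, ω ∈ limitPoints (fun j : ℕ =>
      g * (DiscreteHeisenberg.b ^ ((j : ℤ) - 1) * DiscreteHeisenberg.a *
        DiscreteHeisenberg.b))}.Infinite ∧
    -- the explicit geodesic rays, whose limits are pairwise distinct Busemann points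
    (∀ i, IsGeodesicRay (natRay (DiscreteHeisenberg.ray i))) ∧
    (∃ ω : (ℤ × ℤ × ℤˣ) ⊕ (ℤ × ℤ × ℤˣ) → MetricCompactification DiscreteHeisenberg,
      Function.Injective ω ∧
      ∀ i, ω i ∈ busemannPoints DiscreteHeisenberg ∧
        Tendsto (fun t => toCompactification (DiscreteHeisenberg.ray i t)) atTop (𝓝 (ω i))) := by
  refine ⟨DiscreteHeisenberg.closure_generators, ?_, ?_, ?_,
    DiscreteHeisenberg.disjoint_limitPoints_second, DiscreteHeisenberg.disjoint_limitPoints_third,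
    DiscreteHeisenberg.infinite_limitPoints,
    fun i => isGeodesicRay_natRay (DiscreteHeisenberg.dist_ray i), ?_⟩
  · intro j hj
    obtain ⟨i, rfl⟩ := Nat.exists_eq_add_of_le' hj
    have h := DiscreteHeisenberg.isUniqueMinimalPath_pow_a_b i 0
    rw [DiscreteHeisenberg.b_zpow_mul_a_mul_b, DiscreteHeisenberg.one_eq, Nat.add_sub_cancel]
    push_cast
    rwa [zero_add] at h
  · intro j hj
    obtain ⟨i, rfl⟩ := Nat.exists_eq_add_of_le' hj
    have h := DiscreteHeisenberg.isUniqueMinimalPath_pow_a i 2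
    have h' := DiscreteHeisenberg.perimeter_first (j := ((i + 2 : ℕ) : ℤ)) (by lia)
    rw [DiscreteHeisenberg.b_zpow_mul_a_mul_b, DiscreteHeisenberg.a_mul_b_mul_a_inv_mul_b,
      DiscreteHeisenberg.one_eq, Nat.add_sub_cancel]
    refine ⟨?_, by exact_mod_cast h'⟩
    push_cast
    rwa [add_comm] at h
  · intro A B g hA hB
    -- Writing A and B as images of a and b under an automorphism θ turns every word in A and B into
    -- the θ-image of the word in a and b.
    obtain ⟨θ, rfl, rfl, hθ⟩ := DiscreteHeisenberg.exists_cayleyIso hA hB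
    obtain ⟨φ, hφ⟩ := hθ g
    refine ⟨?_, ?_, ?_, ?_, fun k => ?_, fun k hk => ?_⟩
    · simpa only [hφ, map_mul, map_inv, map_zpow, map_one] using
        DiscreteHeisenberg.giveNonBusemannPoints_first φ
    · simpa only [hφ, map_mul, map_inv, map_pow, map_one] using
        DiscreteHeisenberg.giveNonBusemannPoints_second φ
    · simpa only [hφ, map_mul, map_inv, map_pow, map_one] using
        DiscreteHeisenberg.giveNonBusemannPoints_third φ
    · simpa only [hφ, map_mul, map_inv, map_pow] using
        DiscreteHeisenberg.giveNonBusemannPoints_square φ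
    · simpa only [map_mul, map_inv, map_pow] using congrArg θ
        ((DiscreteHeisenberg.commutator_pow k).trans (DiscreteHeisenberg.commutator_pow' k).symm)
    · have h := DiscreteHeisenberg.isRigidTriple_map φ
        (DiscreteHeisenberg.isRigidTriple_square (k := k) (by lia))
      rw [← DiscreteHeisenberg.commutator_pow, ← DiscreteHeisenberg.b_inv,
        show DiscreteHeisenberg.mk 0 0 1 = DiscreteHeisenberg.b from rfl] at h
      simpa only [hφ, map_mul, map_inv, map_pow] using h
  · have hcof := fun i => DiscreteHeisenberg.tendsto_cofinite_of_injective
      (DiscreteHeisenberg.ray_injective i)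
    choose ω hω using fun i =>
      exists_tendsto_toCompactification (DiscreteHeisenberg.dist_ray i) (hcof i)
    refine ⟨ω, fun i j hij => ?_, fun i =>
      ⟨mem_busemannPoints_of_tendsto (DiscreteHeisenberg.dist_ray i) (hcof i) (hω i), hω i⟩⟩
    by_contra hne
    exact DiscreteHeisenberg.limit_ray_ne hne (hω i) (hij ▸ hω j)
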